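/- **Conventions.** For a group $G$, $L(G)=\lambda(G)''\subset B(\ell^2(G))$ is the group von Neumann algebra of the left regular representation $\lambda$, with trace $\tau(x)=\langle x\delta_1|\delta_1\rangle$ and $\|x\|_2=\tau(x^*x)^{1/2}$. For a subgroup $H\subset G$, $L(H)$ is identified with the von Neumann subalgebra $\lambda(H)''$ of $L(G)$. Let $\omega$ be a free ultrafilter on $\mathbb N$. For a von Neumann algebra $M$ with faithful normal tracial state, $M^\omega$ is the quotient of $\ell^\infty(\mathbb N,M)$ by the ideal of the sequences $(a_n)$ with $\lim_{n\to\omega}\|a_n\|_2=0$; $M$ is embedded in $M^\omega$ by constant sequences, and for a von Neumann subalgebra $N\subset M$ one regards $N^\omega\subset M^\omega$ and puts $N_\omega=N'\cap N^\omega$. A subgroup $H$ of $G$ is *inner amenable relative to* $G$ if $H\neq G$ and there is a state on $\ell^\infty(G\smallsetminus H)$ invariant under conjugation by $H$. A group $H$ is *inner amenable* if there is a conjugation-invariant state on $\ell^\infty(H\smallsetminus\{1\})$, and *icc* if every nontrivial conjugacy class of $H$ is infinite. A factor $M$ as above is *full* if $M_\omega=\mathbb C$ for every free ultrafilter $\omega$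 on $\mathbb N$. A subfactor $N$ of a factor $M$ is *irreducible* if $N'\cap M\subset N$. $M$ has *property gamma* if there are unitaries $u_n\in M$ with $\tau(u_n)=0$ for all $n$ and $\|[y,u_n]\|_2\to0$ for every $y\in M$. $N\subset M$ has *property gamma relative to* $M$ if there is a bounded sequence $(x_n)\subset M$ with $\|x_n\|_2=1$ and $\mathbb E_N(x_n)=0$ for all $n$, and $\|[x_n,y]\|_2\to0$ for every $y\in N$, where $\mathbb E_N$ is the trace-preserving conditional expectation onto $N$. **Proposition.** (1) Let $H\subset G$ be infinite countable groups such that $H$ is not inner amenable relative to $G$. Then, for every free ultrafilter $\omega$ on $\mathbb N$, $$L(H)'\cap L(G)^\omega=L(H)_\omega .$$ If, in addition, $H$ is not inner amenable, then $L(H)'\cap L(G)^\omega=\mathbb C$ for every free ultrafilter $\omega$ on $\mathbb N$; in this case $L(H)$ and $L(G)$ are type II$_1$ factors, $L(G)$ is full, and $L(H)$ is an irreducible subfactor of $L(G)$. (2) Let $H$ be a countable icc group, embedded diagonally in $H\times H$. Then $L(H\times H)=L(H)\,\overline\otimes\,L(H)$, and $L(H)$ (the von Neumann subalgebra of $L(H\times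 H)$ generated by the diagonal subgroup) is an irreducible subfactor of $L(H\times H)$; if $H\neq\{1\}$, both are type II$_1$ factors. If $L(H)$ has property gamma, then it has property gamma relative to $L(H\times H)$. -/

import Mathlib

open scoped ENNReal ComplexOrder

universe u v

noncomputable section

/-! ### Invariant states and (relative) inner amenability -/

/-- The translate `h · a` of a bounded function, `(h · a) x = a (h⁻¹ · x)`, where `h` acts
through the permutation `σ` of `X`. -/
def linftyTranslate {X : Type u} (σ : Equiv.Perm X) (a : lp (fun _ : X => ℂ) ∞) :
    lp (fun _ : X => ℂ) ∞ :=
  ⟨fun x => a (σ.symm x), memℓp_infty <| by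
    obtain ⟨C, hC⟩ := memℓp_infty_iff.1 (lp.memℓp a)
    refine ⟨C, ?_⟩
    rintro _ ⟨x, rfl⟩
    exact hC ⟨σ.symm x, rfl⟩⟩

/-- The action of `H` on `X` given by `act` is amenable: there is a state on `ℓ^∞(X)`, i.e. a
positive linear functional of value `1` at the constant function `1`, which is `H`-invariant. -/
def HasInvariantState {H : Type v} [Group H] {X : Type u} (act : H →* Equiv.Perm X) : Prop :=
  ∃ φ : lp (fun _ : X => ℂ) ∞ →ₗ[ℂ] ℂ,
    (∀ a : lp (fun _ : X => ℂ) ∞, (∀ x, 0 ≤ a x) → 0 ≤ φ a) ∧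
    φ 1 = 1 ∧
    ∀ (h : H) (a : lp (fun _ : X => ℂ) ∞), φ (linftyTranslate (act h) a) = φ a

/-- The action of a subgroup `H` by conjugation on the complement `G ∖ H`. -/
def conjComplement {G : Type u} [Group G] (H : Subgroup G) :
    H →* Equiv.Perm {g : G // g ∉ H} where
  toFun h :=
    { toFun := fun g => ⟨h * g * (h : G)⁻¹, fun hg => g.2 <| by
        simpa [mul_assoc] using H.mul_mem (H.mul_mem (H.inv_mem h.2) hg) h.2⟩
      invFun := fun g => ⟨(h : G)⁻¹ * g * h, fun hg => g.2 <| by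
        simpa [mul_assoc] using H.mul_mem (H.mul_mem h.2 hg) (H.inv_mem h.2)⟩
      left_inv := fun g => Subtype.ext (by simp [mul_assoc])
      right_inv := fun g => Subtype.ext (by simp [mul_assoc]) }
  map_one' := by ext g; simp
  map_mul' h k := by ext g; simp [mul_assoc]

/-- `H` is inner amenable relative to `G`. -/
def RelInnerAmenable {G : Type u} [Group G] (H : Subgroup G) : Prop :=
  H ≠ ⊤ ∧ HasInvariantState (conjComplement H)

/-- The action of a group `G` by conjugation on `G ∖ {1}`. -/
def conjNonOne (G : Type u) [Group G] : G →* Equiv.Perm {g : G // g ≠ 1} where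
  toFun h :=
    { toFun := fun g => ⟨h * g * h⁻¹, fun hg => g.2 <| by
        simpa using hg⟩
      invFun := fun g => ⟨h⁻¹ * g * h, fun hg => g.2 <| by
        simpa [mul_assoc] using congrArg (fun t => h * t * h⁻¹) hg⟩
      left_inv := fun g => Subtype.ext (by simp [mul_assoc])
      right_inv := fun g => Subtype.ext (by simp [mul_assoc]) }
  map_one' := by ext g; simp
  map_mul' h k := by ext g; simp [mul_assoc]

/-- `G` is inner amenable: there is a conjugation invariant state on `ℓ^∞(G ∖ {1})`. -/
def InnerAmenable (G : Type u) [Group G] : Prop :=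
  HasInvariantState (conjNonOne G)

/-- Infinite conjugacy classes: every nontrivial conjugacy class is infinite. -/
def IsICC (G : Type u) [Group G] : Prop :=
  ∀ g : G, g ≠ 1 → (Set.range fun h : G => h * g * h⁻¹).Infinite

/-! ### Von Neumann algebras -/

section VN

variable {E : Type u} [NormedAddCommGroup E] [InnerProductSpace ℂ E] [CompleteSpace E]

/-- The von Neumann algebra generated by a set `S` of operators: the bicommutant of `S ∪ S*`. -/
def vnGen (S : Set (E →L[ℂ] E)) : VonNeumannAlgebra E where
  toStarSubalgebra := StarSubalgebra.centralizer ℂ (StarSubalgebra.centralizer ℂ S : Set _)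
  centralizer_centralizer' := by
    change Set.centralizer (Set.centralizer
      ((StarSubalgebra.centralizer ℂ (StarSubalgebra.centralizer ℂ S : Set (E →L[ℂ] E)) :
        StarSubalgebra ℂ (E →L[ℂ] E)) : Set (E →L[ℂ] E))) =
      ((StarSubalgebra.centralizer ℂ (StarSubalgebra.centralizer ℂ S : Set (E →L[ℂ] E)) :
        StarSubalgebra ℂ (E →L[ℂ] E)) : Set (E →L[ℂ] E))
    rw [StarSubalgebra.coe_centralizer_centralizer, Set.centralizer_centralizer_centralizer]

theorem mem_vnGen_iff {S : Set (E →L[ℂ] E)} {x : E →L[ℂ] E} :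
    x ∈ vnGen S ↔
      ∀ y : E →L[ℂ] E, (∀ s ∈ S, s * y = y * s ∧ star s * y = y * star s) → y * x = x * y := by
  change x ∈ (StarSubalgebra.centralizer ℂ (StarSubalgebra.centralizer ℂ S : Set _)) ↔ _
  rw [← SetLike.mem_coe, StarSubalgebra.coe_centralizer_centralizer,
    ← StarSubalgebra.coe_centralizer ℂ S]
  simp only [Set.mem_centralizer_iff, SetLike.mem_coe, StarSubalgebra.mem_centralizer_iff]

/-- `A` is a factor: its center `A ∩ A'` is `ℂ`. -/
def IsFactor (A : VonNeumannAlgebra E) : Prop :=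
  ∀ x ∈ A, x ∈ A.commutant → ∃ c : ℂ, x = c • (1 : E →L[ℂ] E)

/-- `A` is a type II₁ factor: an infinite-dimensional factor with a faithful tracial state. -/
def IsTypeII1Factor (A : VonNeumannAlgebra E) : Prop :=
  IsFactor A ∧ ¬ FiniteDimensional ℂ A.toStarSubalgebra ∧
    ∃ φ : A.toStarSubalgebra →ₗ[ℂ] ℂ, φ 1 = 1 ∧ (∀ x, 0 ≤ φ (star x * x)) ∧
      (∀ x, φ (star x * x) = 0 → x = 0) ∧ ∀ x y, φ (x * y) = φ (y * x)

/-- `N` is an irreducible subfactor of `M`: both are factors, `N ⊆ M` and `N' ∩ M ⊆ N`. -/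
def IsIrreducibleSubfactor (N M : VonNeumannAlgebra E) : Prop :=
  IsFactor N ∧ IsFactor M ∧ (∀ x ∈ N, x ∈ M) ∧ ∀ x ∈ M, x ∈ N.commutant → x ∈ N

variable (E) in
/-- A finite von Neumann algebra with a faithful normal normalized trace, represented so that the
trace is the vector state of the unit vector `vec`. -/
structure TracialVNA where
  alg : VonNeumannAlgebra E
  vec : E
  norm_vec : ‖vec‖ = 1
  tracial : ∀ x ∈ alg, ∀ y ∈ alg,
    (inner ℂ vec ((x * y) vec) : ℂ) = inner ℂ vec ((y * x) vec)
  faithful : ∀ x ∈ alg, x vec = 0 → x = 0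

namespace TracialVNA

variable (M : TracialVNA E)

/-- The trace `τ`. -/
def trace (x : E →L[ℂ] E) : ℂ := inner ℂ M.vec (x M.vec)

/-- The norm `‖x‖₂ = τ(x* x)^{1/2}`. -/
def twoNorm (x : E →L[ℂ] E) : ℝ := ‖x M.vec‖

theorem twoNorm_sq (x : E →L[ℂ] E) : ((M.twoNorm x : ℂ)) ^ 2 = M.trace (star x * x) := by
  rw [twoNorm, trace, ContinuousLinearMap.star_eq_adjoint, mul_apply_eq_comp,
    ContinuousLinearMap.adjoint_inner_right, inner_self_eq_norm_sq_to_K]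
  rfl

theorem twoNorm_star {x : E →L[ℂ] E} (hx : x ∈ M.alg) : M.twoNorm (star x) = M.twoNorm x := by
  have h : ((M.twoNorm (star x) : ℂ)) ^ 2 = ((M.twoNorm x : ℂ)) ^ 2 := by
    rw [twoNorm_sq, twoNorm_sq, star_star]
    exact M.tracial _ hx _ (star_mem hx)
  have h' : M.twoNorm (star x) ^ 2 = M.twoNorm x ^ 2 := by exact_mod_cast h
  exact (sq_eq_sq₀ (norm_nonneg _) (norm_nonneg _)).1 h'

theorem twoNorm_mul_le_left (x y : E →L[ℂ] E) : M.twoNorm (x * y) ≤ ‖x‖ * M.twoNorm y :=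
  x.le_opNorm (y M.vec)

theorem twoNorm_mul_le_right {x y : E →L[ℂ] E} (hx : x ∈ M.alg) (hy : y ∈ M.alg) :
    M.twoNorm (x * y) ≤ ‖y‖ * M.twoNorm x := by
  rw [← M.twoNorm_star (mul_mem hx hy), star_mul, ← M.twoNorm_star hx, ← norm_star y]
  exact M.twoNorm_mul_le_left _ _

/-- `y` is the image `𝔼_N(x)` of `x` under the trace-preserving conditional expectation onto `N`,
i.e. `y` is the (unique) element of `N` with `τ(y z) = τ(x z)` for all `z ∈ N`. -/
def IsCondExp (N : VonNeumannAlgebra E) (x y : E →L[ℂ] E) : Prop :=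
  y ∈ N ∧ ∀ z ∈ N, M.trace (y * z) = M.trace (x * z)

/-- Murray and von Neumann's property gamma. -/
def HasPropertyGamma : Prop :=
  ∃ w : ℕ → (E →L[ℂ] E),
    (∀ n, w n ∈ M.alg ∧ w n ∈ unitary (E →L[ℂ] E) ∧ M.trace (w n) = 0) ∧
    ∀ y ∈ M.alg, Filter.Tendsto (fun n => M.twoNorm (w n * y - y * w n)) Filter.atTop (nhds 0)

/-- The von Neumann subalgebra `N` has property gamma relative to `M`. -/
def HasRelPropertyGamma (N : VonNeumannAlgebra E) : Prop :=
  ∃ x : ℕ → (E →L[ℂ] E),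
    (∀ n, x n ∈ M.alg) ∧ (∃ C : ℝ, ∀ n, ‖x n‖ ≤ C) ∧
    (∀ n, M.twoNorm (x n) = 1) ∧ (∀ n, M.IsCondExp N (x n) 0) ∧
    ∀ y ∈ N, Filter.Tendsto (fun n => M.twoNorm (x n * y - y * x n)) Filter.atTop (nhds 0)

end TracialVNA

/-! ### Ultraproducts -/

/-- The algebra `ℓ^∞(ℕ, A)` of bounded sequences in `A`. -/
def boundedSeq (A : VonNeumannAlgebra E) : Subalgebra ℂ (ℕ → (E →L[ℂ] E)) where
  carrier := {a | (∀ n, a n ∈ A) ∧ ∃ C : ℝ, ∀ n, ‖a n‖ ≤ C}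
  mul_mem' := by
    rintro a b ⟨ha, C, hC⟩ ⟨hb, D, hD⟩
    exact ⟨fun n => mul_mem (ha n) (hb n), C * D, fun n => (norm_mul_le _ _).trans <|
      mul_le_mul (hC n) (hD n) (norm_nonneg _) ((norm_nonneg _).trans (hC n))⟩
  add_mem' := by
    rintro a b ⟨ha, C, hC⟩ ⟨hb, D, hD⟩
    exact ⟨fun n => add_mem (ha n) (hb n), C + D, fun n => (norm_add_le _ _).trans <|
      add_le_add (hC n) (hD n)⟩
  algebraMap_mem' c :=
    ⟨fun _ => A.toStarSubalgebra.algebraMap_mem c, ‖algebraMap ℂ (E →L[ℂ] E) c‖, fun _ => le_rfl⟩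

/-- The constant sequence `(x, x, …)`. -/
def constSeq (A : VonNeumannAlgebra E) (x : A) : boundedSeq A :=
  ⟨fun _ => x, fun _ => x.2, ‖(x : E →L[ℂ] E)‖, fun _ => le_rfl⟩

namespace TracialVNA

variable (M : TracialVNA E) (ω : Ultrafilter ℕ)

/-- The ideal `I_ω` of the bounded sequences `(a_n)` in `M` with `lim_{n → ω} ‖a_n‖₂ = 0`. -/
def nullIdeal : Ideal (boundedSeq M.alg) where
  carrier := {a | Filter.Tendsto (fun n => M.twoNorm (a.1 n)) ω (nhds 0)}
  zero_mem' := by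
    have : (fun n => M.twoNorm ((0 : boundedSeq M.alg).1 n)) = fun _ => 0 := by
      funext n; simp [twoNorm]
    simp only [Set.mem_ofPred_eq, this]
    exact tendsto_const_nhds
  add_mem' := by
    intro a b ha hb
    have h := Filter.Tendsto.add ha hb
    rw [add_zero] at h
    exact squeeze_zero (fun n => norm_nonneg _) (fun n => norm_add_le _ _) h
  smul_mem' := by
    intro c a ha
    obtain ⟨C, hC⟩ := c.2.2
    have h := Filter.Tendsto.const_mul C ha
    rw [mul_zero] at h
    exact squeeze_zero (fun n => norm_nonneg _) (fun n => (M.twoNorm_mul_le_left _ _).trans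
      (mul_le_mul_of_nonneg_right (hC n) (norm_nonneg _))) h

instance : (M.nullIdeal ω).IsTwoSided where
  mul_mem_of_left := by
    intro a b ha
    obtain ⟨C, hC⟩ := b.2.2
    have h := Filter.Tendsto.const_mul C ha
    rw [mul_zero] at h
    exact squeeze_zero (fun n => norm_nonneg _)
      (fun n => (M.twoNorm_mul_le_right (a.2.1 n) (b.2.1 n)).trans
        (mul_le_mul_of_nonneg_right (hC n) (norm_nonneg _))) h

/-- The ultrapower `M^ω = ℓ^∞(ℕ, M) / I_ω`. -/
abbrev Ultrapower : Type u := boundedSeq M.alg ⧸ M.nullIdeal ω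

/-- The relative commutant `N' ∩ M^ω`, for `N ⊆ M ⊆ M^ω` through constant sequences. -/
def relCommutant (N : VonNeumannAlgebra E) : Subalgebra ℂ (M.Ultrapower ω) :=
  Subalgebra.centralizer ℂ
    {X | ∃ y : M.alg, (y : E →L[ℂ] E) ∈ N ∧
      X = Ideal.Quotient.mkₐ ℂ (M.nullIdeal ω) (constSeq M.alg y)}

/-- The subalgebra `N^ω` of `M^ω`, for `N ⊆ M`: the classes of the bounded sequences in `N`. -/
def subUltrapower (N : VonNeumannAlgebra E) : Subalgebra ℂ (M.Ultrapower ω) :=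
  ((boundedSeq N).comap (boundedSeq M.alg).val).map (Ideal.Quotient.mkₐ ℂ (M.nullIdeal ω))

/-- The algebra `N_ω = N' ∩ N^ω`, for `N ⊆ M`, inside `M^ω`. -/
def centralSeqAlgebra (N : VonNeumannAlgebra E) : Subalgebra ℂ (M.Ultrapower ω) :=
  M.relCommutant ω N ⊓ M.subUltrapower ω N

/-- `M` is a full factor: `M` is a factor and `M_ω = ℂ` for every free ultrafilter `ω`. -/
def IsFullFactor : Prop :=
  IsFactor M.alg ∧
    ∀ ω : Ultrafilter ℕ, (∀ n, ω ≠ pure n) → M.centralSeqAlgebra ω M.alg = ⊥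

end TracialVNA

end VN

/-! ### Group von Neumann algebras -/

/-- The Hilbert space `ℓ²(X)`. -/
abbrev L2 (X : Type u) : Type u := lp (fun _ : X => ℂ) 2

section L2

variable {X : Type u}

open Classical in
/-- The vector `δ_x` of the canonical basis. -/
def delta (x : X) : L2 X := lp.single 2 x (1 : ℂ)

theorem inner_delta_left (x : X) (ξ : L2 X) : (inner ℂ (delta x) ξ : ℂ) = ξ x := by
  classical
  have h := lp.inner_single_left (𝕜 := ℂ) (G := fun _ : X => ℂ) x (1 : ℂ) ξ
  simp only [RCLike.inner_apply, map_one, mul_one] at h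
  rw [← h, delta]

theorem norm_delta (x : X) : ‖delta x‖ = 1 := by
  classical
  rw [delta, lp.norm_single (by norm_num), norm_one]

theorem clm_eq_zero_of_delta {x : L2 X →L[ℂ] L2 X} (h : ∀ g, x (delta g) = 0) : x = 0 := by
  have h' : ∀ ξ : L2 X, ∀ g, (star x ξ : L2 X) g = 0 := by
    intro ξ g
    rw [← inner_delta_left, ContinuousLinearMap.star_eq_adjoint,
      ContinuousLinearMap.adjoint_inner_right, h, inner_zero_left]
  have h0 : star x = 0 := by
    ext ξ g
    exact h' ξ g
  simpa using congrArg star h0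

theorem summable_sq (ξ : L2 X) : Summable fun x => ‖ξ x‖ ^ 2 := by
  have h := (lp.memℓp ξ).summable (by norm_num)
  simpa using h

theorem norm_sq_eq (ξ : L2 X) : ‖ξ‖ ^ 2 = ∑' x, ‖ξ x‖ ^ 2 := by
  have h := lp.norm_rpow_eq_tsum (p := 2) (by norm_num) ξ
  simpa using h

/-- The unitary operator of `ℓ²(X)` given by a permutation: `(σ · ξ) x = ξ (σ⁻¹ x)`. -/
def permOp (σ : Equiv.Perm X) : L2 X →L[ℂ] L2 X :=
  LinearMap.mkContinuous
    { toFun := fun ξ => ⟨fun x => ξ (σ.symm x), memℓp_gen <| by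
        have h := (σ.symm.summable_iff).2 (summable_sq ξ)
        simpa [Function.comp_def] using h⟩
      map_add' := fun _ _ => rfl
      map_smul' := fun _ _ => rfl } 1 <| by
    intro ξ
    rw [one_mul]
    refine (sq_le_sq₀ (norm_nonneg _) (norm_nonneg _)).1 ?_
    rw [norm_sq_eq, norm_sq_eq]
    exact (σ.symm.tsum_eq (fun x => ‖ξ x‖ ^ 2)).le

theorem permOp_apply (σ : Equiv.Perm X) (ξ : L2 X) (x : X) :
    (permOp σ ξ : L2 X) x = ξ (σ.symm x) := rfl

theorem star_permOp (σ : Equiv.Perm X) : star (permOp σ) = permOp σ.symm := by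
  rw [ContinuousLinearMap.star_eq_adjoint, eq_comm, ContinuousLinearMap.eq_adjoint_iff]
  intro ξ η
  rw [lp.inner_eq_tsum, lp.inner_eq_tsum, ← σ.symm.tsum_eq]
  simp [permOp_apply]

theorem permOp_delta (σ : Equiv.Perm X) (x : X) : permOp σ (delta x) = delta (σ x) := by
  classical
  ext y
  rw [permOp_apply, delta, delta, lp.single_apply, lp.single_apply, Pi.single_apply,
    Pi.single_apply, Equiv.symm_apply_eq]

/-- The elementary tensor `ξ ⊗ η` in `ℓ²(X) ⊗ ℓ²(Y) = ℓ²(X × Y)`. -/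
def tensorVec {Y : Type v} (ξ : L2 X) (η : L2 Y) : L2 (X × Y) :=
  ⟨fun p => ξ p.1 * η p.2, memℓp_gen <| by
    have h := (summable_sq ξ).mul_of_nonneg (summable_sq η) (fun _ => sq_nonneg _)
      (fun _ => sq_nonneg _)
    simpa [mul_pow] using h⟩

/-- The von Neumann tensor product `A ⊗ B` on `ℓ²(X) ⊗ ℓ²(Y) = ℓ²(X × Y)`: the von Neumann
algebra generated by the operators `x ⊗ y`, `ξ ⊗ η ↦ x ξ ⊗ y η`, for `x ∈ A` and `y ∈ B`. -/
def vnTensor {Y : Type v} (A : VonNeumannAlgebra (L2 X)) (B : VonNeumannAlgebra (L2 Y)) :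
    VonNeumannAlgebra (L2 (X × Y)) :=
  vnGen {T | ∃ x ∈ A, ∃ y ∈ B, ∀ (ξ : L2 X) (η : L2 Y),
    T (tensorVec ξ η) = tensorVec (x ξ) (y η)}

end L2

section GroupVN

variable {G : Type u} [Group G]

/-- The left regular representation, `(λ(g) ξ) g' = ξ (g⁻¹ g')`. -/
def leftReg (g : G) : L2 G →L[ℂ] L2 G := permOp (Equiv.mulLeft g)

/-- The von Neumann subalgebra `L(H)` of `L(G)`, generated by `λ(H)` in `B(ℓ²(G))`. -/
def subgroupVN (H : Subgroup G) : VonNeumannAlgebra (L2 G) :=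
  vnGen {x | ∃ h ∈ H, x = leftReg h}

theorem apply_delta_of_mem {x : L2 G →L[ℂ] L2 G} (hx : x ∈ vnGen (Set.range (leftReg (G := G))))
    (g k : G) : (x (delta g) : L2 G) k = (x (delta 1) : L2 G) (k * g⁻¹) := by
  have hc := mem_vnGen_iff.1 hx (permOp (Equiv.mulRight g)) (by
    rintro _ ⟨h, rfl⟩
    rw [leftReg, star_permOp]
    constructor <;>
    · ext ξ k
      simp [permOp_apply, mul_assoc])
  have h1 := congrArg (fun T : L2 G →L[ℂ] L2 G => (T (delta 1) : L2 G) k) hc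
  simp only [mul_apply_eq_comp, permOp_delta, permOp_apply, Equiv.coe_mulRight,
    one_mul] at h1
  rw [← h1]
  simp

theorem star_apply_delta_of_mem {x : L2 G →L[ℂ] L2 G}
    (hx : x ∈ vnGen (Set.range (leftReg (G := G)))) (g : G) :
    (star x (delta 1) : L2 G) g = starRingEnd ℂ ((x (delta 1) : L2 G) g⁻¹) := by
  rw [← inner_delta_left, ContinuousLinearMap.star_eq_adjoint,
    ContinuousLinearMap.adjoint_inner_right, ← inner_conj_symm, inner_delta_left,
    apply_delta_of_mem hx, one_mul]

variable (G) in
/-- The group von Neumann algebra `L(G)`, the bicommutant of `λ(G)` in `B(ℓ²(G))`, with its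
trace `τ(x) = ⟨x δ_1, δ_1⟩`. -/
def groupVN : TracialVNA (L2 G) where
  alg := vnGen (Set.range leftReg)
  vec := delta 1
  norm_vec := norm_delta 1
  tracial := by
    have key : ∀ x ∈ vnGen (Set.range (leftReg (G := G))), ∀ y : L2 G →L[ℂ] L2 G,
        (inner ℂ (delta 1) ((x * y) (delta 1)) : ℂ) =
          ∑' g, (y (delta 1) : L2 G) g * (x (delta 1) : L2 G) g⁻¹ := by
      intro x hx y
      have h := ContinuousLinearMap.adjoint_inner_left x (y (delta 1)) (delta (1 : G))
      rw [mul_apply_eq_comp, ← h, ← ContinuousLinearMap.star_eq_adjoint,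
        lp.inner_eq_tsum]
      refine tsum_congr fun g => ?_
      rw [star_apply_delta_of_mem hx, RCLike.inner_apply, RCLike.conj_conj]
    intro x hx y hy
    rw [key x hx, key y hy, ← (Equiv.inv G).tsum_eq]
    refine tsum_congr fun g => ?_
    simp [mul_comm]
  faithful := by
    intro x hx h
    refine clm_eq_zero_of_delta fun g => ?_
    ext k
    rw [apply_delta_of_mem hx, h]
    rfl

end GroupVN

/-- The diagonal subgroup of `H × H`. -/
def diagonalSubgroup (H : Type u) [Group H] : Subgroup (H × H) :=
  ((MonoidHom.id H).prod (MonoidHom.id H)).range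

end

noncomputable section

/-! ### Operators on `ℓ²` -/

section Operators

variable {X : Type u} {Y : Type v}

/-! An element `x` of `L(G)` is determined by its coefficient vector `ξ = x δ_1` in `ℓ²(G)`. The
trace norm of `x` is `‖ξ‖`, and `‖[λ(h), x]‖₂` is the distance from `ξ` to its conjugate by `h`
(`norm_conj_sub_eq_twoNorm`). A sequence representing an element of `L(H)' ∩ L(G)^ω` is therefore a
sequence of vectors asymptotically invariant under conjugation by `H`.

If such vectors, restricted to an `H`-invariant set, do not tend to `0`, normalizing them and taking
the `ω`-limit of their vector states gives an invariant state on that set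
(`tendsto_norm_zero_of_not_hasInvariantState`). On `G ∖ H` this shows that `a_n` is asymptotic to
its expectation on `L(H)`, so that the class lies in `L(H)^ω`. On `H ∖ {1}` it shows that only the
coefficient at `1` survives, so that the class is scalar. Constant sequences then make `L(H)' ∩
L(G)` trivial, which yields factoriality and irreducibility; fullness follows from `L(G)' ∩ L(G)^ω ⊆
L(H)' ∩ L(G)^ω`.

For the diagonal of `H × H`, an element of the relative commutant has coefficients constant on
conjugation orbits of the diagonal. Away from `1` these orbits are infinite, so square summability
kills the coefficients. If trace-zero unitaries `w_n` witness gamma for `L(H)`, the operators `1 ⊗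
w_n` witness relative gamma: they commute with `λ(h, h)` as well as `w_n` does with `λ(h)`, and
their support `{1} × H` meets the diagonal only at `1`, where the coefficient is `τ(w_n) = 0`. -/

theorem memlp_two_of_summable {f : X → ℂ} (h : Summable fun x => ‖f x‖ ^ 2) : Memℓp f 2 :=
  memℓp_gen (by simpa using h)

theorem delta_apply_self (x : X) : (delta x : L2 X) x = 1 := by
  classical
  simp [delta]

theorem delta_apply_of_ne {x y : X} (h : y ≠ x) : (delta x : L2 X) y = 0 := by
  classical
  simp [delta, h]

theorem inner_delta_right (x : X) (ξ : L2 X) :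
    (inner ℂ ξ (delta x) : ℂ) = starRingEnd ℂ (ξ x) := by
  rw [← inner_conj_symm, inner_delta_left]

theorem orthonormal_delta : Orthonormal ℂ (delta : X → L2 X) := by
  refine ⟨norm_delta, fun x y h => ?_⟩
  change (inner ℂ (delta x) (delta y) : ℂ) = 0
  rw [inner_delta_left, delta_apply_of_ne h]

/-- The matrix expansion of an operator. -/
theorem hasSum_apply (T : L2 X →L[ℂ] L2 Y) (ξ : L2 X) (b : Y) :
    HasSum (fun c => ξ c * (T (delta c) : L2 Y) b) ((T ξ : L2 Y) b) := by
  have h := lp.hasSum_inner (𝕜 := ℂ) (T.adjoint (delta b)) ξ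
  rw [ContinuousLinearMap.adjoint_inner_left, inner_delta_left] at h
  have hc (c : X) : (inner ℂ (T.adjoint (delta b) c) (ξ c) : ℂ) =
      ξ c * (T (delta c) : L2 Y) b := by
    rw [RCLike.inner_apply, ← inner_delta_left c (T.adjoint (delta b)),
      ContinuousLinearMap.adjoint_inner_right, inner_delta_right, RCLike.conj_conj]
  rw [funext hc] at h
  exact h

theorem clm_ext_delta {S T : L2 X →L[ℂ] L2 X}
    (h : ∀ g k, (S (delta g) : L2 X) k = (T (delta g) : L2 X) k) : S = T := by
  rw [← sub_eq_zero]
  refine clm_eq_zero_of_delta fun g => ?_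
  ext k
  simp [h]

theorem norm_permOp (σ : Equiv.Perm X) (ξ : L2 X) : ‖permOp σ ξ‖ = ‖ξ‖ := by
  refine (sq_eq_sq₀ (norm_nonneg _) (norm_nonneg _)).1 ?_
  rw [norm_sq_eq, norm_sq_eq]
  exact σ.symm.tsum_eq (fun x => ‖ξ x‖ ^ 2)

/-- Multiplication by a bounded function. -/
def mulOp (a : lp (fun _ : X => ℂ) ∞) : L2 X →L[ℂ] L2 X :=
  have key (ξ : L2 X) (x : X) : ‖a x * ξ x‖ ^ 2 ≤ ‖a‖ ^ 2 * ‖ξ x‖ ^ 2 := by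
    rw [norm_mul, mul_pow]
    gcongr
    exact lp.norm_apply_le_norm (by simp) a x
  LinearMap.mkContinuous
    { toFun := fun ξ => ⟨fun x => a x * ξ x, memlp_two_of_summable <|
        ((summable_sq ξ).mul_left (‖a‖ ^ 2)).of_nonneg_of_le (fun _ => sq_nonneg _) (key ξ)⟩
      map_add' := fun ξ η => Subtype.ext (funext fun x => mul_add (a x) (ξ x) (η x))
      map_smul' := fun c ξ => Subtype.ext (funext fun x => mul_left_comm (a x) c (ξ x)) } ‖a‖ <| by
    intro ξ
    refine (sq_le_sq₀ (norm_nonneg _) (by positivity)).1 ?_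
    rw [mul_pow, norm_sq_eq, norm_sq_eq, ← tsum_mul_left]
    exact (((summable_sq ξ).mul_left (‖a‖ ^ 2)).of_nonneg_of_le (fun _ => sq_nonneg _)
      (key ξ)).tsum_le_tsum (key ξ) ((summable_sq ξ).mul_left _)

theorem mulOp_apply (a : lp (fun _ : X => ℂ) ∞) (ξ : L2 X) (x : X) :
    (mulOp a ξ : L2 X) x = a x * ξ x := rfl

theorem norm_mulOp_apply_le (a : lp (fun _ : X => ℂ) ∞) (ξ : L2 X) :
    ‖mulOp a ξ‖ ≤ ‖a‖ * ‖ξ‖ :=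
  ((mulOp a).le_opNorm ξ).trans (by
    gcongr
    unfold mulOp
    exact LinearMap.mkContinuous_norm_le _ (norm_nonneg _) _)

/-- The restriction `ξ ↦ ξ ∘ e` along an injective map. -/
def restrictOp (e : X ↪ Y) : L2 Y →L[ℂ] L2 X :=
  LinearMap.mkContinuous
    { toFun := fun ξ => ⟨fun x => ξ (e x), memlp_two_of_summable <|
        (summable_sq ξ).comp_injective e.injective⟩
      map_add' := fun _ _ => rfl
      map_smul' := fun _ _ => rfl } 1 <| by
    intro ξ
    rw [one_mul]
    refine (sq_le_sq₀ (norm_nonneg _) (norm_nonneg _)).1 ?_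
    rw [norm_sq_eq, norm_sq_eq]
    exact tsum_comp_le_tsum_of_inj (summable_sq ξ) (fun _ => sq_nonneg _) e.injective

theorem restrictOp_apply (e : X ↪ Y) (ξ : L2 Y) (x : X) :
    (restrictOp e ξ : L2 X) x = ξ (e x) := rfl

theorem norm_restrictOp_le (e : X ↪ Y) : ‖restrictOp e‖ ≤ 1 :=
  LinearMap.mkContinuous_norm_le _ zero_le_one _

theorem norm_restrictOp_of_support (e : X ↪ Y) (ξ : L2 Y) (h : ∀ y ∉ Set.range e, ξ y = 0) :
    ‖restrictOp e ξ‖ = ‖ξ‖ := by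
  refine (sq_eq_sq₀ (norm_nonneg _) (norm_nonneg _)).1 ?_
  rw [norm_sq_eq, norm_sq_eq]
  refine e.injective.tsum_eq (f := fun y => ‖ξ y‖ ^ 2) fun y hy => ?_
  by_contra hy'
  exact hy (by simp [h y hy'])

theorem adjoint_restrictOp_delta (e : X ↪ Y) (x : X) :
    (restrictOp e).adjoint (delta x) = delta (e x) := by
  ext y
  rw [← inner_delta_left, ContinuousLinearMap.adjoint_inner_right, inner_delta_right,
    restrictOp_apply]
  rcases eq_or_ne (e x) y with rfl | h
  · rw [delta_apply_self, map_one]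
  · rw [delta_apply_of_ne h, delta_apply_of_ne h.symm, map_zero]

/-- The slice `ξ(i, ·)`. -/
def slice {I : Type u} {Y : Type v} (ξ : L2 (I × Y)) (i : I) : L2 Y :=
  restrictOp ⟨fun y => (i, y), fun _ _ h => (Prod.ext_iff.1 h).2⟩ ξ

theorem slice_apply (ξ : L2 (X × Y)) (i : X) (y : Y) : (slice ξ i : L2 Y) y = ξ (i, y) := rfl

theorem slice_add (ξ η : L2 (X × Y)) (i : X) : slice (ξ + η) i = slice ξ i + slice η i :=
  map_add _ _ _

theorem slice_smul (c : ℂ) (ξ : L2 (X × Y)) (i : X) : slice (c • ξ) i = c • slice ξ i :=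
  map_smul _ _ _

theorem summable_norm_slice_sq (ξ : L2 (X × Y)) : Summable fun i => ‖slice ξ i‖ ^ 2 :=
  (summable_congr fun i => norm_sq_eq (slice ξ i)).2 (summable_sq ξ).prod

theorem norm_sq_eq_tsum_slice (ξ : L2 (X × Y)) : ‖ξ‖ ^ 2 = ∑' i, ‖slice ξ i‖ ^ 2 := by
  rw [norm_sq_eq, tsum_congr fun i => norm_sq_eq (slice ξ i)]
  exact (summable_sq ξ).tsum_prod

theorem norm_sq_apply_slice_le (T : L2 Y →L[ℂ] L2 Y) (ξ : L2 (X × Y)) (i : X) :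
    ‖T (slice ξ i)‖ ^ 2 ≤ ‖T‖ ^ 2 * ‖slice ξ i‖ ^ 2 := by
  rw [← mul_pow]
  gcongr
  exact T.le_opNorm _

theorem summable_norm_sq_apply_slice (T : L2 Y →L[ℂ] L2 Y) (ξ : L2 (X × Y)) :
    Summable fun i => ‖T (slice ξ i)‖ ^ 2 :=
  ((summable_norm_slice_sq ξ).mul_left (‖T‖ ^ 2)).of_nonneg_of_le
    (fun _ => sq_nonneg _) (norm_sq_apply_slice_le T ξ)

theorem summable_amplify (T : L2 Y →L[ℂ] L2 Y) (ξ : L2 (X × Y)) :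
    Summable fun p : X × Y => ‖(T (slice ξ p.1) : L2 Y) p.2‖ ^ 2 :=
  (summable_prod_of_nonneg fun _ => sq_nonneg _).2 ⟨fun i => summable_sq (T (slice ξ i)),
    (summable_congr fun i => norm_sq_eq (T (slice ξ i))).1 (summable_norm_sq_apply_slice T ξ)⟩

variable (X) in
/-- The amplification `1 ⊗ T` on `ℓ²(X × Y)`. -/
def amplify (T : L2 Y →L[ℂ] L2 Y) : L2 (X × Y) →L[ℂ] L2 (X × Y) :=
  LinearMap.mkContinuous
    { toFun := fun ξ => ⟨fun p => (T (slice ξ p.1) : L2 Y) p.2,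
        memlp_two_of_summable (summable_amplify T ξ)⟩
      map_add' := fun ξ η => Subtype.ext <| funext fun p => by
        change (T (slice (ξ + η) p.1) : L2 Y) p.2 =
          (T (slice ξ p.1) : L2 Y) p.2 + (T (slice η p.1) : L2 Y) p.2
        rw [slice_add, map_add]
        rfl
      map_smul' := fun c ξ => Subtype.ext <| funext fun p => by
        change (T (slice (c • ξ) p.1) : L2 Y) p.2 = c * (T (slice ξ p.1) : L2 Y) p.2
        rw [slice_smul, map_smul]
        rfl } ‖T‖ <| by
    intro ξ
    refine (sq_le_sq₀ (norm_nonneg _) (by positivity)).1 ?_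
    rw [mul_pow, norm_sq_eq_tsum_slice, norm_sq_eq_tsum_slice, ← tsum_mul_left]
    exact (summable_norm_sq_apply_slice T ξ).tsum_le_tsum (norm_sq_apply_slice_le T ξ)
      ((summable_norm_slice_sq ξ).mul_left _)

theorem amplify_apply (T : L2 Y →L[ℂ] L2 Y) (ξ : L2 (X × Y)) (p : X × Y) :
    (amplify X T ξ : L2 (X × Y)) p = (T (slice ξ p.1) : L2 Y) p.2 := rfl

theorem norm_amplify_le (T : L2 Y →L[ℂ] L2 Y) : ‖amplify X T‖ ≤ ‖T‖ :=
  LinearMap.mkContinuous_norm_le _ (norm_nonneg _) _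

theorem slice_delta_self (i : X) (y : Y) : slice (delta (i, y)) i = delta y := by
  ext z
  rw [slice_apply]
  rcases eq_or_ne z y with rfl | h
  · rw [delta_apply_self, delta_apply_self]
  · rw [delta_apply_of_ne h, delta_apply_of_ne (by simp [h])]

theorem slice_delta_of_ne {i j : X} (h : j ≠ i) (y : Y) : slice (delta (i, y)) j = 0 := by
  ext z
  rw [slice_apply, delta_apply_of_ne (by simp [h])]
  rfl

theorem amplify_delta_same (T : L2 Y →L[ℂ] L2 Y) (i : X) (y z : Y) :
    (amplify X T (delta (i, y)) : L2 (X × Y)) (i, z) = (T (delta y) : L2 Y) z := by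
  rw [amplify_apply, slice_delta_self]

theorem amplify_delta_of_ne (T : L2 Y →L[ℂ] L2 Y) {i j : X} (h : j ≠ i) (y z : Y) :
    (amplify X T (delta (i, y)) : L2 (X × Y)) (j, z) = 0 := by
  rw [amplify_apply, slice_delta_of_ne h, map_zero]
  rfl

theorem delta_prod (x : X) (y : Y) : delta (x, y) = tensorVec (delta x) (delta y) := by
  classical
  ext p
  change (delta (x, y) : L2 (X × Y)) p = (delta x : L2 X) p.1 * (delta y : L2 Y) p.2
  simp only [delta, lp.single_apply, Pi.single_apply, Prod.ext_iff]
  split_ifs <;> simp_all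

end Operators

/-! ### Almost invariant vectors and invariant states -/

section States

variable {X : Type u} {K : Type v} [Group K]

/-- In `ℓ^∞(∅)` one has `1 = 0`, so no functional is normalized. This covers `H = ⊤`, a case that
`RelInnerAmenable` rules out by a separate clause. -/
theorem not_hasInvariantState_of_isEmpty [IsEmpty X] (act : K →* Equiv.Perm X) :
    ¬ HasInvariantState act := by
  rintro ⟨φ, -, h1, -⟩
  have : (1 : lp (fun _ : X => ℂ) ∞) = 0 := by
    ext x
    exact isEmptyElim x
  rw [this, map_zero] at h1
  exact zero_ne_one h1

theorem exists_tendsto_of_norm_le {E : Type v} [NormedAddCommGroup E] [ProperSpace E]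
    (ω : Ultrafilter ℕ) {f : ℕ → E} {C : ℝ}
    (hf : ∀ n, ‖f n‖ ≤ C) : ∃ z, Filter.Tendsto f ω (nhds z) := by
  have hK := isCompact_closedBall (0 : E) C
  obtain ⟨z, -, hz⟩ := hK.ultrafilter_le_nhds (ω.map f) (by
    rw [Filter.le_principal_iff]
    change ∀ᶠ n in (ω : Filter ℕ), f n ∈ Metric.closedBall 0 C
    exact Filter.Eventually.of_forall fun n => by simpa using hf n)
  exact ⟨z, hz⟩

theorem mulOp_linftyTranslate (σ : Equiv.Perm X) (a : lp (fun _ : X => ℂ) ∞) (ξ : L2 X) :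
    mulOp (linftyTranslate σ a) ξ = permOp σ (mulOp a (permOp σ.symm ξ)) := by
  ext x
  simp only [mulOp_apply, permOp_apply, Equiv.symm_symm, Equiv.apply_symm_apply]
  rfl

/-- Translating the function amounts to moving the vector the other way; almost invariance of
vectors thus becomes invariance of the limit of their states. -/
theorem inner_mulOp_linftyTranslate (σ : Equiv.Perm X) (a : lp (fun _ : X => ℂ) ∞) (ξ : L2 X) :
    (inner ℂ ξ (mulOp (linftyTranslate σ a) ξ) : ℂ) =
      inner ℂ (permOp σ.symm ξ) (mulOp a (permOp σ.symm ξ)) := by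
  rw [mulOp_linftyTranslate, ← star_permOp, ContinuousLinearMap.star_eq_adjoint,
    ContinuousLinearMap.adjoint_inner_left]

theorem norm_inner_mulOp_sub_le (a : lp (fun _ : X => ℂ) ∞) {ξ η : L2 X} (hξ : ‖ξ‖ ≤ 1)
    (hη : ‖η‖ ≤ 1) :
    ‖(inner ℂ ξ (mulOp a ξ) : ℂ) - inner ℂ η (mulOp a η)‖ ≤ 2 * ‖a‖ * ‖ξ - η‖ := by
  have h : (inner ℂ ξ (mulOp a ξ) : ℂ) - inner ℂ η (mulOp a η) =
      inner ℂ (ξ - η) (mulOp a ξ) + inner ℂ η (mulOp a (ξ - η)) := by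
    rw [map_sub, inner_sub_left, inner_sub_right]
    ring
  rw [h]
  refine (norm_add_le _ _).trans ?_
  have h1 : ‖(inner ℂ (ξ - η) (mulOp a ξ) : ℂ)‖ ≤ ‖ξ - η‖ * (‖a‖ * 1) :=
    (norm_inner_le_norm _ _).trans (by
      gcongr
      exact (norm_mulOp_apply_le a ξ).trans (by gcongr))
  have h2 : ‖(inner ℂ η (mulOp a (ξ - η)) : ℂ)‖ ≤ 1 * (‖a‖ * ‖ξ - η‖) :=
    (norm_inner_le_norm _ _).trans (by
      gcongr
      exact norm_mulOp_apply_le a _)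
  linarith

/-- A sequence of unit vectors which is asymptotically invariant yields an invariant state. -/
theorem hasInvariantState_of_unit_vectors (act : K →* Equiv.Perm X) (ω : Ultrafilter ℕ)
    (ζ : ℕ → L2 X) (hle : ∀ n, ‖ζ n‖ ≤ 1) (hone : ∀ᶠ n in (ω : Filter ℕ), ‖ζ n‖ = 1)
    (hinv : ∀ h, Filter.Tendsto (fun n => ‖permOp (act h) (ζ n) - ζ n‖) ω (nhds 0)) :
    HasInvariantState act := by
  have hlim (a : lp (fun _ : X => ℂ) ∞) :
      ∃ z, Filter.Tendsto (fun n => (inner ℂ (ζ n) (mulOp a (ζ n)) : ℂ)) ω (nhds z) := by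
    refine exists_tendsto_of_norm_le ω (C := ‖a‖) fun n => ?_
    calc _ ≤ ‖ζ n‖ * ‖mulOp a (ζ n)‖ := norm_inner_le_norm _ _
      _ ≤ 1 * (‖a‖ * 1) := by
        gcongr
        · exact hle n
        · exact (norm_mulOp_apply_le a _).trans (by gcongr; exact hle n)
      _ = ‖a‖ := by ring
  choose φ hφ using hlim
  refine ⟨⟨⟨φ, fun a b => ?_⟩, fun c a => ?_⟩, fun a ha => ?_, ?_, fun h a => ?_⟩
  · refine tendsto_nhds_unique (hφ (a + b)) (((hφ a).add (hφ b)).congr fun n => ?_)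
    rw [← inner_add_right]
    congr 1
    ext x
    simp [mulOp_apply, add_mul]
  · refine tendsto_nhds_unique (hφ (c • a)) (((hφ a).const_mul c).congr fun n => ?_)
    rw [← inner_smul_right]
    congr 1
    ext x
    simp [mulOp_apply, mul_assoc]
  · refine ge_of_tendsto' (hφ a) fun n => ?_
    rw [lp.inner_eq_tsum]
    refine tsum_nonneg fun x => ?_
    rw [RCLike.inner_apply, mulOp_apply, mul_assoc]
    exact mul_nonneg (ha x) (mul_star_self_nonneg (ζ n x))
  · refine tendsto_nhds_unique (hφ 1) (tendsto_const_nhds.congr' ?_)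
    filter_upwards [hone] with n hn
    have : mulOp (1 : lp (fun _ : X => ℂ) ∞) (ζ n) = ζ n := by
      ext x
      simp [mulOp_apply]
    rw [this, inner_self_eq_norm_sq_to_K, hn]
    simp
  · have hsub := (hφ (linftyTranslate (act h) a)).sub (hφ a)
    refine sub_eq_zero.1 (tendsto_nhds_unique hsub ?_)
    -- Translating `a` by `h` moves the vectors by `h⁻¹`; the factor `2 * ‖a‖` comes from
    -- `norm_inner_mulOp_sub_le`.
    have h0 := (hinv h⁻¹).const_mul (2 * ‖a‖)
    rw [mul_zero] at h0
    refine squeeze_zero_norm (fun n => ?_) h0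
    rw [inner_mulOp_linftyTranslate]
    have hs : (act h).symm = act h⁻¹ := (map_inv act h).symm
    rw [hs]
    exact norm_inner_mulOp_sub_le a ((norm_permOp _ _).le.trans (hle n)) (hle n)

/-- If an action has no invariant state, then asymptotically invariant vectors tend to `0`. -/
theorem tendsto_norm_zero_of_not_hasInvariantState {act : K →* Equiv.Perm X}
    (hact : ¬ HasInvariantState act) (ω : Ultrafilter ℕ) (ξ : ℕ → L2 X)
    (hinv : ∀ h, Filter.Tendsto (fun n => ‖permOp (act h) (ξ n) - ξ n‖) ω (nhds 0)) :
    Filter.Tendsto (fun n => ‖ξ n‖) ω (nhds 0) := by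
  by_contra hnot
  rw [Metric.tendsto_nhds] at hnot
  push Not at hnot
  obtain ⟨ε, hε, hfreq⟩ := hnot
  -- Along an ultrafilter, frequently and eventually coincide.
  have hev : ∀ᶠ n in (ω : Filter ℕ), ε ≤ ‖ξ n‖ := by
    simpa using hfreq
  -- Since `0⁻¹ = 0`, the normalized vector is `0` where `ξ n = 0`: its norm is at most `1` for
  -- every `n`, and equal to `1` eventually.
  refine hact (hasInvariantState_of_unit_vectors act ω (fun n => ((‖ξ n‖⁻¹ : ℝ) : ℂ) • ξ n)
    (fun n => ?_) ?_ fun h => ?_)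
  · rw [norm_smul, Complex.norm_real, norm_inv, norm_norm]
    exact inv_mul_le_one
  · filter_upwards [hev] with n hn
    rw [norm_smul, Complex.norm_real, norm_inv, norm_norm]
    exact inv_mul_cancel₀ (hε.trans_le hn).ne'
  · have h0 := (hinv h).const_mul ε⁻¹
    rw [mul_zero] at h0
    refine squeeze_zero' (Filter.Eventually.of_forall fun _ => norm_nonneg _) ?_ h0
    filter_upwards [hev] with n hn
    rw [map_smul, ← smul_sub, norm_smul, Complex.norm_real, norm_inv, norm_norm]
    gcongr

end States

/-! ### Matrix coefficients of group von Neumann algebras -/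

section Coefficients

theorem vnGen_le {E : Type u} [NormedAddCommGroup E] [InnerProductSpace ℂ E] [CompleteSpace E]
    {S : Set (E →L[ℂ] E)} {A : VonNeumannAlgebra E} (h : S ⊆ A) {x : E →L[ℂ] E}
    (hx : x ∈ vnGen S) : x ∈ A := by
  rw [← VonNeumannAlgebra.commutant_commutant A, VonNeumannAlgebra.mem_commutant_iff]
  intro y hy
  rw [VonNeumannAlgebra.mem_commutant_iff] at hy
  exact mem_vnGen_iff.1 hx y fun s hs => ⟨hy s (h hs), hy (star s) (star_mem (h hs))⟩

theorem subset_vnGen {E : Type u} [NormedAddCommGroup E] [InnerProductSpace ℂ E]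
    [CompleteSpace E] (S : Set (E →L[ℂ] E)) : S ⊆ vnGen S :=
  fun s hs => mem_vnGen_iff.2 fun _ hy => (hy s hs).1.symm

variable {G : Type u} [Group G]

theorem leftReg_delta (g k : G) : leftReg g (delta k) = delta (g * k) :=
  permOp_delta _ _

theorem leftReg_apply (g : G) (ξ : L2 G) (k : G) : (leftReg g ξ : L2 G) k = ξ (g⁻¹ * k) := rfl

theorem star_leftReg (g : G) : star (leftReg g) = leftReg g⁻¹ := by
  rw [leftReg, star_permOp, Equiv.mulLeft_symm]
  rfl

theorem norm_leftReg_apply (g : G) (ξ : L2 G) : ‖leftReg g ξ‖ = ‖ξ‖ := norm_permOp _ _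

theorem leftReg_mem_subgroupVN {H : Subgroup G} {h : G} (hh : h ∈ H) :
    leftReg h ∈ subgroupVN H :=
  subset_vnGen _ ⟨h, hh, rfl⟩

theorem leftReg_mem_groupVN (g : G) : leftReg g ∈ (groupVN G).alg :=
  subset_vnGen _ ⟨g, rfl⟩

theorem subgroupVN_le (H : Subgroup G) {x : L2 G →L[ℂ] L2 G} (hx : x ∈ subgroupVN H) :
    x ∈ (groupVN G).alg :=
  vnGen_le (by rintro _ ⟨h, -, rfl⟩; exact leftReg_mem_groupVN h) hx

variable (G) in
theorem subgroupVN_top : subgroupVN (⊤ : Subgroup G) = (groupVN G).alg := by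
  unfold subgroupVN groupVN
  congr 1
  ext x
  simp [eq_comm]

open Classical in
/-- The indicator function of a set, as a bounded function. -/
def indicatorFn {X : Type u} (S : Set X) : lp (fun _ : X => ℂ) ∞ :=
  ⟨S.indicator 1, memℓp_infty ⟨1, by
    rintro _ ⟨x, rfl⟩
    by_cases hx : x ∈ S <;> simp [hx]⟩⟩

theorem mulOp_indicatorFn_of_mem {X : Type u} {S : Set X} {x : X} (hx : x ∈ S) (ξ : L2 X) :
    (mulOp (indicatorFn S) ξ : L2 X) x = ξ x := by
  simp [mulOp_apply, indicatorFn, hx]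

theorem mulOp_indicatorFn_of_notMem {X : Type u} {S : Set X} {x : X} (hx : x ∉ S) (ξ : L2 X) :
    (mulOp (indicatorFn S) ξ : L2 X) x = 0 := by
  simp [mulOp_apply, indicatorFn, hx]

/-- Left translation by `h ∈ H` preserves `H`, so the projection onto `ℓ²(H)` lies in `λ(H)'`. Being
fixed by this projection, `δ_1` is sent into `ℓ²(H)` by every element of `L(H)`. -/
theorem leftReg_comm_indicator {H : Subgroup G} {h : G} (hh : h ∈ H) :
    leftReg h * mulOp (indicatorFn (H : Set G)) = mulOp (indicatorFn (H : Set G)) * leftReg h := by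
  ext ξ k
  rw [mul_apply_eq_comp, mul_apply_eq_comp, leftReg_apply]
  by_cases hk : k ∈ H
  · rw [mulOp_indicatorFn_of_mem (show k ∈ (H : Set G) from hk),
      mulOp_indicatorFn_of_mem (show h⁻¹ * k ∈ (H : Set G) from H.mul_mem (H.inv_mem hh) hk),
      leftReg_apply]
  · rw [mulOp_indicatorFn_of_notMem (show k ∉ (H : Set G) from hk),
      mulOp_indicatorFn_of_notMem]
    exact fun hk' => hk ((H.mul_mem_cancel_left (H.inv_mem hh)).1 hk')

theorem support_of_mem_subgroupVN {H : Subgroup G} {x : L2 G →L[ℂ] L2 G}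
    (hx : x ∈ subgroupVN H) {g : G} (hg : g ∉ H) : (x (delta 1) : L2 G) g = 0 := by
  have hc := mem_vnGen_iff.1 hx (mulOp (indicatorFn (H : Set G))) (by
    rintro _ ⟨h, hh, rfl⟩
    rw [star_leftReg]
    exact ⟨leftReg_comm_indicator hh, leftReg_comm_indicator (H.inv_mem hh)⟩)
  have h1 : mulOp (indicatorFn (H : Set G)) (delta 1) = delta 1 := by
    ext k
    by_cases hk : k ∈ H
    · rw [mulOp_indicatorFn_of_mem (show k ∈ (H : Set G) from hk)]
    · rw [mulOp_indicatorFn_of_notMem (show k ∉ (H : Set G) from hk), delta_apply_of_ne]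
      rintro rfl
      exact hk H.one_mem
  have h2 := congrArg (fun T : L2 G →L[ℂ] L2 G => (T (delta 1) : L2 G) g) hc
  simp only [mul_apply_eq_comp] at h2
  rw [h1, mulOp_indicatorFn_of_notMem (show g ∉ (H : Set G) from hg)] at h2
  exact h2.symm

/-- `L(H)` consists of the operators whose matrix is `(t (k g⁻¹))` with `t` supported on `H`. -/
theorem mem_subgroupVN_iff {H : Subgroup G} {x : L2 G →L[ℂ] L2 G} :
    x ∈ subgroupVN H ↔
      (∀ g k, (x (delta g) : L2 G) k = (x (delta 1) : L2 G) (k * g⁻¹)) ∧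
        ∀ g ∉ H, (x (delta 1) : L2 G) g = 0 := by
  refine ⟨fun hx => ⟨apply_delta_of_mem (subgroupVN_le H hx),
    fun g hg => support_of_mem_subgroupVN hx hg⟩, fun ⟨hker, hsupp⟩ => ?_⟩
  refine mem_vnGen_iff.2 fun y hy => clm_ext_delta fun a b => ?_
  have hl := hasSum_apply y (x (delta a)) b
  have hr := hasSum_apply x (y (delta a)) b
  -- Both coefficients become sums over `h`, through `c = h * a` on one side and `c = h⁻¹ * b` on
  -- the other. Each term is then `t h` times a coefficient of `y`, and for `h ∈ H` these
  -- coefficients agree because `y` commutes with `λ(h)`.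
  rw [← (Equiv.mulRight a).hasSum_iff] at hl
  rw [← ((Equiv.inv G).trans (Equiv.mulRight b)).hasSum_iff] at hr
  refine hl.unique (hr.congr_fun fun h => ?_)
  simp only [Function.comp_apply, Equiv.coe_mulRight, Equiv.trans_apply, Equiv.inv_apply]
  rw [hker a, hker (h⁻¹ * b), mul_inv_cancel_right, mul_inv_rev, inv_inv, mul_inv_cancel_left]
  by_cases hh : h ∈ H
  · have h1 := congrArg (fun T : L2 G →L[ℂ] L2 G => (T (delta a) : L2 G) b) (hy _ ⟨h, hh, rfl⟩).1
    simp only [mul_apply_eq_comp, leftReg_delta, leftReg_apply] at h1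
    rw [← h1, mul_comm]
  · rw [hsupp h hh, zero_mul, mul_zero]

theorem mem_groupVN_iff {x : L2 G →L[ℂ] L2 G} :
    x ∈ (groupVN G).alg ↔
      ∀ g k, (x (delta g) : L2 G) k = (x (delta 1) : L2 G) (k * g⁻¹) := by
  rw [← subgroupVN_top, mem_subgroupVN_iff]
  simp

theorem groupVN_trace (x : L2 G →L[ℂ] L2 G) :
    (groupVN G).trace x = (x (delta 1) : L2 G) 1 :=
  inner_delta_left 1 _

theorem groupVN_twoNorm (x : L2 G →L[ℂ] L2 G) : (groupVN G).twoNorm x = ‖x (delta 1)‖ := rfl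

theorem apply_delta_eq_permOp {x : L2 G →L[ℂ] L2 G} (hx : x ∈ (groupVN G).alg) (g : G) :
    x (delta g) = permOp (Equiv.mulRight g) (x (delta 1)) := by
  ext k
  exact apply_delta_of_mem hx g k

theorem eq_smul_one_of_apply_delta {x : L2 G →L[ℂ] L2 G} (hx : x ∈ (groupVN G).alg)
    (h : ∀ g ≠ 1, (x (delta 1) : L2 G) g = 0) :
    x = (groupVN G).trace x • (1 : L2 G →L[ℂ] L2 G) := by
  refine clm_ext_delta fun g k => ?_
  rw [apply_delta_of_mem hx, groupVN_trace]
  change _ = (x (delta 1) : L2 G) 1 * (delta g : L2 G) k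
  rcases eq_or_ne k g with rfl | hk
  · rw [delta_apply_self, mul_inv_cancel, mul_one]
  · rw [delta_apply_of_ne hk, mul_zero]
    exact h _ (by rwa [ne_eq, mul_inv_eq_one])

/-- `‖σ_g ξ - ξ‖`, for `σ_g` the conjugation by `g`, is the `2`-norm of a commutator. -/
theorem norm_conj_sub_eq_twoNorm {x : L2 G →L[ℂ] L2 G} (hx : x ∈ (groupVN G).alg) (g : G) :
    ‖permOp (MulAut.conj g).toEquiv (x (delta 1)) - x (delta 1)‖ =
      (groupVN G).twoNorm (leftReg g * x - x * leftReg g) := by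
  rw [← norm_permOp (Equiv.mulRight g), groupVN_twoNorm]
  congr 1
  change _ = leftReg g (x (delta 1)) - x (leftReg g (delta 1))
  rw [leftReg_delta, mul_one, apply_delta_eq_permOp hx g, map_sub]
  congr 1
  ext k
  rw [permOp_apply, permOp_apply, leftReg_apply]
  simp [MulAut.conj_symm_apply, mul_assoc]

/-! ### The conditional expectation onto `L(H)` -/

/-- The embedding of `G` into the disjoint union of copies of `G` indexed by `H \ G`. -/
def cosetEmbedding (H : Subgroup G) : G ↪ Quotient (QuotientGroup.rightRel H) × G :=
  ⟨fun g => (Quotient.mk _ g, g), fun _ _ h => (Prod.ext_iff.1 h).2⟩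

/-- The compression of an operator to the right cosets of `H`. On `L(G)` this is the conditional
expectation onto `L(H)`. -/
def cosetCompression (H : Subgroup G) (x : L2 G →L[ℂ] L2 G) : L2 G →L[ℂ] L2 G :=
  restrictOp (cosetEmbedding H) ∘L amplify _ x ∘L (restrictOp (cosetEmbedding H)).adjoint

/-- This is what the compression form is for: truncating coefficients has no evident operator norm
bound, whereas a compression is contractive, so bounded sequences keep bounded expectations. -/
theorem norm_cosetCompression_le (H : Subgroup G) (x : L2 G →L[ℂ] L2 G) :
    ‖cosetCompression H x‖ ≤ ‖x‖ := by
  have h1 := norm_restrictOp_le (cosetEmbedding H)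
  have h2 : ‖(restrictOp (cosetEmbedding H)).adjoint‖ ≤ 1 := by
    rwa [LinearIsometryEquiv.norm_map]
  calc _ ≤ 1 * (‖x‖ * 1) := by
        refine (ContinuousLinearMap.opNorm_comp_le _ _).trans (mul_le_mul h1 ?_
          (norm_nonneg _) zero_le_one)
        exact (ContinuousLinearMap.opNorm_comp_le _ _).trans (mul_le_mul (norm_amplify_le x) h2
          (norm_nonneg _) (norm_nonneg _))
    _ = ‖x‖ := by ring

theorem cosetCompression_apply_delta_of_mem (H : Subgroup G) (x : L2 G →L[ℂ] L2 G) {g k : G}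
    (h : k * g⁻¹ ∈ H) :
    (cosetCompression H x (delta g) : L2 G) k = (x (delta g) : L2 G) k := by
  have hq : (Quotient.mk (QuotientGroup.rightRel H) k) = Quotient.mk _ g :=
    Quotient.sound ((QuotientGroup.rightRel_apply).2 (by simpa using H.inv_mem h))
  change (amplify _ x ((restrictOp (cosetEmbedding H)).adjoint (delta g)) : L2 _)
    (Quotient.mk _ k, k) = _
  rw [adjoint_restrictOp_delta, hq]
  exact amplify_delta_same x _ g k

theorem cosetCompression_apply_delta_of_notMem (H : Subgroup G) (x : L2 G →L[ℂ] L2 G) {g k : G}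
    (h : k * g⁻¹ ∉ H) : (cosetCompression H x (delta g) : L2 G) k = 0 := by
  have hq : (Quotient.mk (QuotientGroup.rightRel H) k) ≠ Quotient.mk _ g := fun e => h (by
    simpa using H.inv_mem ((QuotientGroup.rightRel_apply).1 (Quotient.exact e)))
  change (amplify _ x ((restrictOp (cosetEmbedding H)).adjoint (delta g)) : L2 _)
    (Quotient.mk _ k, k) = _
  rw [adjoint_restrictOp_delta]
  exact amplify_delta_of_ne x hq g k

theorem cosetCompression_mem (H : Subgroup G) {x : L2 G →L[ℂ] L2 G}
    (hx : x ∈ (groupVN G).alg) : cosetCompression H x ∈ subgroupVN H := by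
  refine mem_subgroupVN_iff.2 ⟨fun g k => ?_, fun g hg =>
    cosetCompression_apply_delta_of_notMem H x (by simpa using hg)⟩
  by_cases h : k * g⁻¹ ∈ H
  · rw [cosetCompression_apply_delta_of_mem H x h,
      cosetCompression_apply_delta_of_mem H x (by simpa using h), apply_delta_of_mem hx]
  · rw [cosetCompression_apply_delta_of_notMem H x h,
      cosetCompression_apply_delta_of_notMem H x (by simpa using h)]

end Coefficients

/-! ### Relative commutants in ultrapowers -/

section Ultraproducts

open Filter Topology

/-! ### Relative commutants in an ultrapower, expressed by representing sequences. -/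

section General

variable {E : Type u} [NormedAddCommGroup E] [InnerProductSpace ℂ E] [CompleteSpace E]
  (M : TracialVNA E) (ω : Ultrafilter ℕ)

theorem mk_eq_mk_iff (a b : boundedSeq M.alg) :
    Ideal.Quotient.mkₐ ℂ (M.nullIdeal ω) a = Ideal.Quotient.mkₐ ℂ (M.nullIdeal ω) b ↔
      Tendsto (fun n => M.twoNorm (a.1 n - b.1 n)) ω (𝓝 0) := by
  change Ideal.Quotient.mk (M.nullIdeal ω) a = Ideal.Quotient.mk (M.nullIdeal ω) b ↔ _
  rw [Ideal.Quotient.mk_eq_mk_iff_sub_mem]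
  rfl

theorem mk_mem_relCommutant_iff (N : VonNeumannAlgebra E) (a : boundedSeq M.alg) :
    Ideal.Quotient.mkₐ ℂ (M.nullIdeal ω) a ∈ M.relCommutant ω N ↔
      ∀ y ∈ M.alg, y ∈ N → Tendsto (fun n => M.twoNorm (y * a.1 n - a.1 n * y)) ω (𝓝 0) := by
  rw [TracialVNA.relCommutant, Subalgebra.mem_centralizer_iff]
  constructor
  · intro h y hyM hyN
    have h1 := h _ ⟨⟨y, hyM⟩, hyN, rfl⟩
    rw [← map_mul, ← map_mul, mk_eq_mk_iff] at h1
    exact h1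
  · rintro h _ ⟨y, hyN, rfl⟩
    rw [← map_mul, ← map_mul, mk_eq_mk_iff]
    exact h y y.2 hyN

theorem relCommutant_antitone {N P : VonNeumannAlgebra E} (h : ∀ x ∈ N, x ∈ P) :
    M.relCommutant ω P ≤ M.relCommutant ω N :=
  Subalgebra.centralizer_le ℂ _ _ (by
    rintro _ ⟨y, hy, rfl⟩
    exact ⟨y, h _ hy, rfl⟩)

theorem mk_mem_subUltrapower (N : VonNeumannAlgebra E) (a b : boundedSeq M.alg)
    (hN : b.1 ∈ boundedSeq N) (h : Tendsto (fun n => M.twoNorm (a.1 n - b.1 n)) ω (𝓝 0)) :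
    Ideal.Quotient.mkₐ ℂ (M.nullIdeal ω) a ∈ M.subUltrapower ω N :=
  ⟨b, hN, ((mk_eq_mk_iff M ω a b).2 h).symm⟩

/-- An element of `M` which commutes with `N` is a scalar if `N' ∩ M^ω` is trivial. -/
theorem eq_smul_one_of_relCommutant_eq_bot {N : VonNeumannAlgebra E}
    (h : M.relCommutant ω N = ⊥) {x : E →L[ℂ] E} (hx : x ∈ M.alg) (hc : x ∈ N.commutant) :
    ∃ c : ℂ, x = c • (1 : E →L[ℂ] E) := by
  have hmem : Ideal.Quotient.mkₐ ℂ (M.nullIdeal ω) (constSeq M.alg ⟨x, hx⟩) ∈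
      M.relCommutant ω N := by
    rw [mk_mem_relCommutant_iff]
    intro y _ hyN
    have h0 : y * x - x * y = 0 := sub_eq_zero.2 (VonNeumannAlgebra.mem_commutant_iff.1 hc y hyN)
    change Tendsto (fun _ : ℕ => M.twoNorm (y * x - x * y)) ω (𝓝 0)
    rw [h0]
    simp [TracialVNA.twoNorm]
  rw [h, Algebra.mem_bot] at hmem
  obtain ⟨c, hc⟩ := hmem
  refine ⟨c, ?_⟩
  rw [← (Ideal.Quotient.mkₐ ℂ (M.nullIdeal ω)).commutes c, mk_eq_mk_iff] at hc
  have h1 : M.twoNorm (algebraMap ℂ (E →L[ℂ] E) c - x) = 0 :=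
    tendsto_nhds_unique tendsto_const_nhds hc
  have h2 := M.faithful _ (sub_mem (M.alg.toStarSubalgebra.algebraMap_mem c) hx) (norm_eq_zero.1 h1)
  rw [← sub_eq_zero.1 h2, Algebra.algebraMap_eq_smul_one]

end General

/-! ### Sequences in `L(G)` commuting asymptotically with `λ(H)`. -/

variable {G : Type u} [Group G] (H : Subgroup G)

/-- If the conjugation action of `H` on the image of `e` has no invariant state, then the
coefficients on this image of a sequence commuting asymptotically with `λ(H)` tend to `0`. -/
theorem tendsto_norm_restrictOp_of_not_hasInvariantState {X : Type u} {act : H →* Equiv.Perm X}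
    (hact : ¬ HasInvariantState act) (e : X ↪ G)
    (he : ∀ (h : H) (x : X), e (act h x) = h * e x * (h : G)⁻¹) (ω : Ultrafilter ℕ)
    {a : ℕ → L2 G →L[ℂ] L2 G} (ha : ∀ n, a n ∈ (groupVN G).alg)
    (hcomm : ∀ h ∈ H, Tendsto
      (fun n => (groupVN G).twoNorm (leftReg h * a n - a n * leftReg h)) ω (𝓝 0)) :
    Tendsto (fun n => ‖restrictOp e (a n (delta 1))‖) ω (𝓝 0) := by
  refine tendsto_norm_zero_of_not_hasInvariantState hact ω _ fun h => ?_
  refine squeeze_zero (fun _ => norm_nonneg _) (fun n => ?_) (hcomm h h.2)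
  rw [← norm_conj_sub_eq_twoNorm (ha n)]
  have hcomp (ξ : L2 G) : permOp (act h) (restrictOp e ξ) =
      restrictOp e (permOp (MulAut.conj (h : G)).toEquiv ξ) := by
    ext x
    rw [permOp_apply, restrictOp_apply, restrictOp_apply, permOp_apply]
    have hx : e ((act h).symm x) = (MulAut.conj (h : G)).toEquiv.symm (e x) := by
      rw [Equiv.eq_symm_apply]
      change h * e _ * (h : G)⁻¹ = _
      rw [← he, Equiv.apply_symm_apply]
    rw [hx]
  rw [hcomp, ← map_sub]
  refine ((restrictOp e).le_opNorm _).trans ?_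
  exact mul_le_of_le_one_left (norm_nonneg _) (norm_restrictOp_le e)

theorem not_hasInvariantState_conjComplement (h : ¬ RelInnerAmenable H) :
    ¬ HasInvariantState (conjComplement H) := by
  by_cases hH : H = ⊤
  · have : IsEmpty {g : G // g ∉ H} := ⟨fun g => g.2 (by simp [hH])⟩
    exact not_hasInvariantState_of_isEmpty _
  · exact fun hs => h ⟨hH, hs⟩

theorem tendsto_leftReg_commutator_of_mem_relCommutant {ω : Ultrafilter ℕ}
    {a : boundedSeq (groupVN G).alg}
    (ha : Ideal.Quotient.mkₐ ℂ ((groupVN G).nullIdeal ω) a ∈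
      (groupVN G).relCommutant ω (subgroupVN H)) (h : G) (hh : h ∈ H) :
    Tendsto (fun n => (groupVN G).twoNorm (leftReg h * a.1 n - a.1 n * leftReg h)) ω (𝓝 0) :=
  (mk_mem_relCommutant_iff _ ω _ a).1 ha _ (leftReg_mem_groupVN h) (leftReg_mem_subgroupVN hh)

/-- The coefficient vector of `a_n - E(a_n)` is the part of `a_n δ_1` off `H`, which tends to `0`
because conjugation on `G ∖ H` has no invariant state. -/
theorem relCommutant_le_subUltrapower (h : ¬ RelInnerAmenable H) (ω : Ultrafilter ℕ) :
    (groupVN G).relCommutant ω (subgroupVN H) ≤ (groupVN G).subUltrapower ω (subgroupVN H) := by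
  intro X hX
  obtain ⟨a, rfl⟩ := Ideal.Quotient.mkₐ_surjective ℂ _ X
  obtain ⟨C, hC⟩ := a.2.2
  have hE (n : ℕ) := cosetCompression_mem H (a.2.1 n)
  have hEC (n : ℕ) := (norm_cosetCompression_le H (a.1 n)).trans (hC n)
  refine mk_mem_subUltrapower _ ω _ a
    ⟨fun n => cosetCompression H (a.1 n), fun n => subgroupVN_le H (hE n), C, hEC⟩
    ⟨hE, C, hEC⟩ ?_
  refine (tendsto_norm_restrictOp_of_not_hasInvariantState H
    (not_hasInvariantState_conjComplement H h) (Function.Embedding.subtype _) (fun _ _ => rfl) ω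
    a.2.1 (tendsto_leftReg_commutator_of_mem_relCommutant H hX)).congr fun n => ?_
  rw [groupVN_twoNorm, ← norm_restrictOp_of_support (Function.Embedding.subtype (· ∉ H))]
  · congr 1
    ext g
    change (a.1 n (delta 1) : L2 G) g.1 =
      (a.1 n (delta 1) : L2 G) g.1 - (cosetCompression H (a.1 n) (delta 1) : L2 G) g.1
    rw [cosetCompression_apply_delta_of_notMem H _ (by simpa using g.2), sub_zero]
  · intro g hg
    change (a.1 n (delta 1) : L2 G) g - (cosetCompression H (a.1 n) (delta 1) : L2 G) g = 0
    rw [cosetCompression_apply_delta_of_mem, sub_self]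
    simpa using hg

theorem relCommutant_eq_centralSeqAlgebra (h : ¬ RelInnerAmenable H) (ω : Ultrafilter ℕ) :
    (groupVN G).relCommutant ω (subgroupVN H) =
      (groupVN G).centralSeqAlgebra ω (subgroupVN H) :=
  (inf_eq_left.2 (relCommutant_le_subUltrapower H h ω)).symm

theorem norm_trace_le {x : L2 G →L[ℂ] L2 G} : ‖(groupVN G).trace x‖ ≤ ‖x‖ := by
  rw [groupVN_trace]
  refine (lp.norm_apply_le_norm (by norm_num) (x (delta 1)) 1).trans ?_
  simpa [norm_delta] using x.le_opNorm (delta 1)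

/-- The coefficients on `H ∖ {1}` tend to `0`, and those off `H` vanish for a representative in
`L(H)`. What remains is the trace, whose `ω`-limit is the scalar. -/
theorem centralSeqAlgebra_eq_bot (h : ¬ InnerAmenable H) (ω : Ultrafilter ℕ) :
    (groupVN G).centralSeqAlgebra ω (subgroupVN H) = ⊥ := by
  rw [eq_bot_iff]
  rintro X ⟨hX, a, haN, rfl⟩
  replace haN : ∀ n, a.1 n ∈ subgroupVN H := haN.1
  obtain ⟨C, hC⟩ := a.2.2
  obtain ⟨c, hc⟩ := exists_tendsto_of_norm_le ω fun n => norm_trace_le.trans (hC n)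
  rw [Algebra.mem_bot]
  refine ⟨c, ?_⟩
  rw [← (Ideal.Quotient.mkₐ ℂ ((groupVN G).nullIdeal ω)).commutes c]
  refine ((mk_eq_mk_iff _ ω _ _).2 ?_).symm
  let e : {g : H // g ≠ 1} ↪ G :=
    (Function.Embedding.subtype _).trans (Function.Embedding.subtype _)
  have h1 : Tendsto (fun n => ‖restrictOp e (a.1 n (delta 1))‖) ω (𝓝 0) :=
    tendsto_norm_restrictOp_of_not_hasInvariantState H h e (fun _ _ => rfl) ω a.2.1
      (tendsto_leftReg_commutator_of_mem_relCommutant H hX)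
  have h2 : Tendsto (fun n => ‖(groupVN G).trace (a.1 n) - c‖) ω (𝓝 0) := by
    simpa using (hc.sub_const c).norm
  have h12 := h1.add h2
  rw [add_zero] at h12
  refine squeeze_zero (fun _ => norm_nonneg _) (fun n => ?_) h12
  set t := (groupVN G).trace (a.1 n) with ht
  have hsplit : (a.1 n - algebraMap ℂ (L2 G →L[ℂ] L2 G) c) (delta 1) =
      (a.1 n (delta 1) - t • delta 1) + (t - c) • delta 1 := by
    rw [Algebra.algebraMap_eq_smul_one, sub_smul]
    change a.1 n (delta 1) - c • delta 1 = _
    abel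
  change ‖(a.1 n - algebraMap ℂ (L2 G →L[ℂ] L2 G) c) (delta 1)‖ ≤ _
  rw [hsplit]
  refine (norm_add_le _ _).trans (add_le_add (le_of_eq ?_) (by rw [norm_smul, norm_delta, mul_one]))
  rw [← norm_restrictOp_of_support e]
  · congr 1
    ext g
    change (a.1 n (delta 1) : L2 G) (e g) - t * (delta 1 : L2 G) (e g) = _
    rw [delta_apply_of_ne, mul_zero, sub_zero, restrictOp_apply]
    exact fun hg => g.2 (Subtype.ext hg)
  · intro g hg
    change (a.1 n (delta 1) : L2 G) g - t * (delta 1 : L2 G) g = 0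
    rcases eq_or_ne g 1 with rfl | hg1
    · rw [delta_apply_self, ht, groupVN_trace, mul_one, sub_self]
    · rw [delta_apply_of_ne hg1, support_of_mem_subgroupVN (haN n), mul_zero, sub_zero]
      exact fun hgH => hg ⟨⟨⟨g, hgH⟩, fun h1 => hg1 (congrArg Subtype.val h1)⟩, rfl⟩

/-! ### Factors -/

/-- A factor `L(H)` with `H` infinite is of type II₁. -/
theorem isTypeII1Factor_of_isFactor [Infinite H] (hf : IsFactor (subgroupVN H)) :
    IsTypeII1Factor (subgroupVN H) := by
  refine ⟨hf, fun hfin => ?_, ⟨⟨⟨fun x => (groupVN G).trace x, fun x y => ?_⟩, fun c x => ?_⟩,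
    ?_, fun x => ?_, fun x hx => ?_, fun x y => ?_⟩⟩
  -- Evaluation at `δ_1` carries the `λ(h)` to the orthonormal vectors `δ_h`, so they form an
  -- infinite independent family.
  · let ev : (subgroupVN H).toStarSubalgebra →ₗ[ℂ] L2 G :=
      { toFun := fun x => (x : L2 G →L[ℂ] L2 G) (delta 1)
        map_add' := fun _ _ => rfl
        map_smul' := fun _ _ => rfl }
    let b : H → (subgroupVN H).toStarSubalgebra :=
      fun h => ⟨leftReg (h : G), leftReg_mem_subgroupVN h.2⟩
    have hli : LinearIndependent ℂ b := by
      refine LinearIndependent.of_comp ev ?_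
      have : ev ∘ b = fun h : H => (delta (h : G) : L2 G) := by
        funext h
        change leftReg (h : G) (delta 1) = _
        rw [leftReg_delta, mul_one]
      rw [this]
      exact orthonormal_delta.linearIndependent.comp _ Subtype.val_injective
    exact not_finite_iff_infinite.2 ‹Infinite H› hli.finite
  · simp [groupVN_trace]
  · simp [groupVN_trace]
  · change (groupVN G).trace 1 = 1
    rw [groupVN_trace]
    exact delta_apply_self 1
  · change 0 ≤ (groupVN G).trace (star (x : L2 G →L[ℂ] L2 G) * x)
    rw [← TracialVNA.twoNorm_sq]
    exact_mod_cast sq_nonneg ((groupVN G).twoNorm (x : L2 G →L[ℂ] L2 G))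
  · change (groupVN G).trace (star (x : L2 G →L[ℂ] L2 G) * x) = 0 at hx
    rw [← TracialVNA.twoNorm_sq, sq_eq_zero_iff, Complex.ofReal_eq_zero] at hx
    exact Subtype.ext ((groupVN G).faithful _ (subgroupVN_le H x.2) (norm_eq_zero.1 hx))
  · exact (groupVN G).tracial _ (subgroupVN_le H x.2) _ (subgroupVN_le H y.2)

theorem isTypeII1Factor_groupVN [Infinite G] (hf : IsFactor (groupVN G).alg) :
    IsTypeII1Factor (groupVN G).alg := by
  rw [← subgroupVN_top] at hf ⊢
  have : Infinite (⊤ : Subgroup G) := Subgroup.topEquiv.toEquiv.infinite_iff.2 ‹_›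
  exact isTypeII1Factor_of_isFactor ⊤ hf

/-- If the relative commutant of `L(H)` in `L(G)` is trivial, then `L(H)` is an irreducible
subfactor. -/
theorem isIrreducibleSubfactor_of_relative_commutant
    (h : ∀ x ∈ (groupVN G).alg, x ∈ (subgroupVN H).commutant →
      ∃ c : ℂ, x = c • (1 : L2 G →L[ℂ] L2 G)) :
    IsIrreducibleSubfactor (subgroupVN H) (groupVN G).alg := by
  refine ⟨fun x hx hc => h x (subgroupVN_le H hx) hc, fun x hx hc => h x hx ?_,
    fun x => subgroupVN_le H, fun x hx hc => ?_⟩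
  · rw [VonNeumannAlgebra.mem_commutant_iff] at hc ⊢
    exact fun y hy => hc y (subgroupVN_le H hy)
  · obtain ⟨c, rfl⟩ := h x hx hc
    rw [← Algebra.algebraMap_eq_smul_one]
    exact (subgroupVN H).toStarSubalgebra.algebraMap_mem c

end Ultraproducts

/-! ### Diagonal subgroups of products -/

section Diagonal

open Filter Topology

theorem amplify_sub {X : Type u} {Y : Type v} (S T : L2 Y →L[ℂ] L2 Y) :
    amplify X (S - T) = amplify X S - amplify X T := rfl

theorem amplify_mul {X : Type u} {Y : Type v} (S T : L2 Y →L[ℂ] L2 Y) :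
    amplify X (S * T) = amplify X S * amplify X T := rfl

theorem norm_amplify_delta {X : Type u} {Y : Type v} (T : L2 Y →L[ℂ] L2 Y) (i : X) (y : Y) :
    ‖amplify X T (delta (i, y))‖ = ‖T (delta y)‖ := by
  let e : Y ↪ X × Y := ⟨fun y => (i, y), fun _ _ h => (Prod.ext_iff.1 h).2⟩
  rw [← norm_restrictOp_of_support e]
  · congr 1
    ext z
    exact amplify_delta_same T i y z
  · rintro ⟨j, z⟩ hj
    refine amplify_delta_of_ne T ?_ y z
    rintro rfl
    exact hj ⟨z, rfl⟩

/-! ### Operators `1 ⊗ T` and the tensor decomposition for direct products. -/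

section Product

variable {H : Type u} {K : Type v} [Group H] [Group K]

theorem leftReg_prod (h : H) (k : K) :
    leftReg (h, k) = leftReg (h, 1) * amplify H (leftReg k) := by
  ext ξ p
  change ξ (h⁻¹ * p.1, k⁻¹ * p.2) = ξ (h⁻¹ * p.1, k⁻¹ * (1⁻¹ * p.2))
  simp

theorem leftReg_comm_amplify (h : H) (T : L2 K →L[ℂ] L2 K) :
    amplify H T * leftReg (h, 1) = leftReg (h, 1) * amplify H T := by
  ext ξ p
  have hs : slice (leftReg (h, (1 : K)) ξ) p.1 = slice ξ (h⁻¹ * p.1) := by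
    ext k
    change ξ (h⁻¹ * p.1, 1⁻¹ * k) = ξ (h⁻¹ * p.1, k)
    simp
  change (T (slice (leftReg (h, (1 : K)) ξ) p.1) : L2 K) p.2 =
    (T (slice ξ (h⁻¹ * p.1)) : L2 K) (1⁻¹ * p.2)
  rw [hs, inv_one, one_mul]

/-- Writing `λ(h, k) = λ(h, 1)(1 ⊗ λ(k))`, the factor `λ(h, 1)` commutes with `1 ⊗ T` and, being
isometric, drops out of the norm. -/
theorem twoNorm_amplify_commutator (T : L2 K →L[ℂ] L2 K) (h : H) (k : K) :
    (groupVN (H × K)).twoNorm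
        (amplify H T * leftReg (h, k) - leftReg (h, k) * amplify H T) =
      (groupVN K).twoNorm (T * leftReg k - leftReg k * T) := by
  have hc : amplify H T * leftReg (h, k) - leftReg (h, k) * amplify H T =
      leftReg (h, 1) * amplify H (T * leftReg k - leftReg k * T) := by
    rw [leftReg_prod, ← mul_assoc, leftReg_comm_amplify, amplify_sub, amplify_mul, amplify_mul,
      mul_sub, mul_assoc, mul_assoc]
  rw [hc, groupVN_twoNorm, mul_apply_eq_comp, norm_leftReg_apply]
  exact norm_amplify_delta _ 1 1

theorem amplify_mem_groupVN {T : L2 K →L[ℂ] L2 K} (hT : T ∈ (groupVN K).alg) :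
    amplify H T ∈ (groupVN (H × K)).alg := by
  refine mem_groupVN_iff.2 ?_
  rintro ⟨g, g'⟩ ⟨k, k'⟩
  change _ = (amplify H T (delta (1, 1)) : L2 (H × K)) (k * g⁻¹, k' * g'⁻¹)
  rcases eq_or_ne k g with rfl | hk
  · rw [amplify_delta_same, mul_inv_cancel, amplify_delta_same, apply_delta_of_mem hT]
  · rw [amplify_delta_of_ne T hk, amplify_delta_of_ne]
    rwa [ne_eq, mul_inv_eq_one]

/-- `L(H × K) = L(H) ⊗ L(K)`. -/
theorem groupVN_prod : (groupVN (H × K)).alg = vnTensor (groupVN H).alg (groupVN K).alg := by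
  refine SetLike.ext fun x => ⟨fun hx => vnGen_le ?_ hx, fun hx => vnGen_le ?_ hx⟩
  · rintro _ ⟨⟨h, k⟩, rfl⟩
    exact subset_vnGen _ ⟨leftReg h, leftReg_mem_groupVN h, leftReg k, leftReg_mem_groupVN k,
      fun ξ η => rfl⟩
  · rintro T ⟨x, hx, y, hy, hT⟩
    refine mem_groupVN_iff.2 ?_
    rintro ⟨g, g'⟩ ⟨k, k'⟩
    change _ = (T (delta (1, 1)) : L2 (H × K)) (k * g⁻¹, k' * g'⁻¹)
    rw [delta_prod, delta_prod, hT, hT]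
    change (x (delta g) : L2 H) k * (y (delta g') : L2 K) k' =
      (x (delta 1) : L2 H) (k * g⁻¹) * (y (delta 1) : L2 K) (k' * g'⁻¹)
    rw [apply_delta_of_mem hx, apply_delta_of_mem hy]

end Product

/-- The entries of a square-summable vector tend to `0` along the cofinite filter. -/
theorem eq_zero_of_infinite_level {X : Type u} (ξ : L2 X) {c : ℂ}
    (h : {x | ξ x = c}.Infinite) : c = 0 := by
  by_contra hc
  have h0 := (summable_sq ξ).tendsto_cofinite_zero.eventually
    (gt_mem_nhds (show (0 : ℝ) < ‖c‖ ^ 2 by positivity))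
  refine h ((eventually_cofinite.1 h0).subset ?_)
  rintro x rfl
  exact lt_irrefl _

/-! ### Commutation with `L(H)` reduced to commutation with the `λ(h)`. -/

section Commutation

variable {G : Type u} [Group G] {H : Subgroup G}

theorem coeff_conj_of_mem_commutant {x : L2 G →L[ℂ] L2 G} (hx : x ∈ (groupVN G).alg)
    (hc : x ∈ (subgroupVN H).commutant) {h : G} (hh : h ∈ H) (g : G) :
    (x (delta 1) : L2 G) (h * g * h⁻¹) = (x (delta 1) : L2 G) g := by
  have h1 := norm_conj_sub_eq_twoNorm hx h
  rw [VonNeumannAlgebra.mem_commutant_iff.1 hc _ (leftReg_mem_subgroupVN hh), sub_self,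
    groupVN_twoNorm, zero_apply, norm_zero, norm_eq_zero, sub_eq_zero] at h1
  have h2 := congrArg (fun ξ : L2 G => ξ (h * g * h⁻¹)) h1
  simp only [permOp_apply] at h2
  rw [← h2, show (MulAut.conj h).toEquiv.symm (h * g * h⁻¹) = g from
    (MulAut.conj h).toEquiv.symm_apply_apply g]

/-- If the nontrivial `H`-conjugacy classes in `G` are infinite, then `L(H)' ∩ L(G)` is
trivial. -/
theorem eq_smul_one_of_infinite_orbits
    (horb : ∀ g : G, g ≠ 1 → (Set.range fun h : H => (h : G) * g * (h : G)⁻¹).Infinite)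
    {x : L2 G →L[ℂ] L2 G} (hx : x ∈ (groupVN G).alg) (hc : x ∈ (subgroupVN H).commutant) :
    ∃ c : ℂ, x = c • (1 : L2 G →L[ℂ] L2 G) := by
  refine ⟨_, eq_smul_one_of_apply_delta hx fun g hg => ?_⟩
  refine eq_zero_of_infinite_level (x (delta 1)) ((horb g hg).mono ?_)
  rintro _ ⟨h, rfl⟩
  exact coeff_conj_of_mem_commutant hx hc h.2 g

/-- The Fourier sums of `y` converge in `‖·‖₂`. Since this is not operator norm convergence, passing
to commutators requires operator norm bounds on the other factor. -/
theorem exists_twoNorm_sub_sum_lt {y : L2 G →L[ℂ] L2 G} {ε : ℝ} (hε : 0 < ε) :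
    ∃ s : Finset G,
      (groupVN G).twoNorm (y - ∑ g ∈ s, (y (delta 1) : L2 G) g • leftReg g) < ε := by
  classical
  have h := lp.hasSum_single (by norm_num) (y (delta (1 : G)))
  obtain ⟨s, hs⟩ := ((Metric.tendsto_nhds.1 h) ε hε).exists
  refine ⟨s, ?_⟩
  rw [dist_eq_norm, ← norm_neg, neg_sub] at hs
  refine lt_of_eq_of_lt ?_ hs
  rw [groupVN_twoNorm, sub_apply, sum_apply]
  congr 2
  refine Finset.sum_congr rfl fun g _ => ?_
  rw [smul_apply, leftReg_delta, mul_one]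
  ext k
  rcases eq_or_ne k g with rfl | hk
  · change _ * (delta k : L2 G) k = _
    rw [delta_apply_self]
    simp
  · change _ * (delta g : L2 G) k = _
    rw [delta_apply_of_ne hk]
    simp [hk]

/-- A bounded sequence commuting asymptotically with `λ(H)` commutes asymptotically with
`L(H)`. -/
theorem tendsto_commutator_of_leftReg {l : Filter ℕ} {x : ℕ → L2 G →L[ℂ] L2 G} {C : ℝ}
    (hx : ∀ n, x n ∈ (groupVN G).alg) (hC : ∀ n, ‖x n‖ ≤ C)
    (hcomm : ∀ h ∈ H, Tendsto
      (fun n => (groupVN G).twoNorm (x n * leftReg h - leftReg h * x n)) l (𝓝 0))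
    {y : L2 G →L[ℂ] L2 G} (hy : y ∈ subgroupVN H) :
    Tendsto (fun n => (groupVN G).twoNorm (x n * y - y * x n)) l (𝓝 0) := by
  have hC0 : 0 ≤ C := (norm_nonneg _).trans (hC 0)
  refine Metric.tendsto_nhds.2 fun ε hε => ?_
  -- Replacing `y` by `z` costs two errors of at most `C * (ε / (4 * (C + 1))) ≤ ε / 4`, leaving `ε
  -- / 2` for the commutator with `z`. Using `C + 1` keeps the denominator positive.
  obtain ⟨s, hs⟩ := exists_twoNorm_sub_sum_lt (y := y) (ε := ε / (4 * (C + 1))) (by positivity)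
  set z := ∑ g ∈ s, (y (delta 1) : L2 G) g • leftReg g with hz
  have hzmem : z ∈ (groupVN G).alg :=
    sum_mem fun g _ => (groupVN G).alg.toStarSubalgebra.smul_mem (leftReg_mem_groupVN g) _
  have hzlim : Tendsto (fun n => ∑ g ∈ s, ‖(y (delta 1) : L2 G) g‖ *
      (groupVN G).twoNorm (x n * leftReg g - leftReg g * x n)) l (𝓝 0) := by
    rw [← Finset.sum_const_zero (s := s)]
    refine tendsto_finsetSum _ fun g _ => ?_
    -- The finite set `s` may leave `H`, but there the coefficients of `y` vanish.
    by_cases hg : g ∈ H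
    · simpa using (hcomm g hg).const_mul ‖(y (delta 1) : L2 G) g‖
    · rw [support_of_mem_subgroupVN hy hg, norm_zero]
      simp only [zero_mul]
      exact tendsto_const_nhds
  have hzb (n : ℕ) : (groupVN G).twoNorm (x n * z - z * x n) ≤ ∑ g ∈ s,
      ‖(y (delta 1) : L2 G) g‖ * (groupVN G).twoNorm (x n * leftReg g - leftReg g * x n) := by
    have he : x n * z - z * x n =
        ∑ g ∈ s, (y (delta 1) : L2 G) g • (x n * leftReg g - leftReg g * x n) := by
      rw [hz, Finset.mul_sum, Finset.sum_mul, ← Finset.sum_sub_distrib]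
      refine Finset.sum_congr rfl fun g _ => ?_
      rw [mul_smul_comm, smul_mul_assoc, smul_sub]
    rw [he, groupVN_twoNorm, sum_apply]
    refine (norm_sum_le _ _).trans (Finset.sum_le_sum fun g _ => ?_)
    rw [smul_apply, norm_smul]
    rfl
  have hd : y - z ∈ (groupVN G).alg := sub_mem (subgroupVN_le H hy) hzmem
  filter_upwards [hzlim.eventually (gt_mem_nhds (half_pos hε))] with n hn
  have h1 : (groupVN G).twoNorm (x n * (y - z)) ≤ C * (ε / (4 * (C + 1))) :=
    ((groupVN G).twoNorm_mul_le_left _ _).trans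
      (mul_le_mul (hC n) hs.le (norm_nonneg _) hC0)
  have h2 : (groupVN G).twoNorm ((y - z) * x n) ≤ C * (ε / (4 * (C + 1))) :=
    ((groupVN G).twoNorm_mul_le_right hd (hx n)).trans
      (mul_le_mul (hC n) hs.le (norm_nonneg _) hC0)
  have h3 : (groupVN G).twoNorm (x n * y - y * x n) ≤
      (groupVN G).twoNorm (x n * z - z * x n) + (groupVN G).twoNorm (x n * (y - z)) +
        (groupVN G).twoNorm ((y - z) * x n) := by
    have he : x n * y - y * x n = (x n * z - z * x n) + x n * (y - z) - (y - z) * x n := by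
      noncomm_ring
    rw [he]
    simp only [groupVN_twoNorm, sub_apply, add_apply]
    exact (norm_sub_le _ _).trans (by gcongr; exact norm_add_le _ _)
  have h4 : C * (ε / (4 * (C + 1))) ≤ ε / 4 := by
    rw [mul_div_assoc', div_le_div_iff₀ (by positivity) (by norm_num)]
    nlinarith
  rw [dist_zero_right, Real.norm_of_nonneg (show 0 ≤ (groupVN G).twoNorm _ from norm_nonneg _)]
  linarith [hzb n]

end Commutation

/-! ### The diagonal subgroup for an icc group. -/

section ICC

variable (H : Type u) [Group H]

theorem mem_diagonalSubgroup_iff {p : H × H} : p ∈ diagonalSubgroup H ↔ p.1 = p.2 := by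
  constructor
  · rintro ⟨h, rfl⟩
    rfl
  · exact fun h => ⟨p.1, Prod.ext rfl h⟩

/-- A coordinate projection in which `p` is nontrivial maps the orbit onto a full conjugacy class of
`H`. -/
theorem infinite_diagonal_orbits (hH : IsICC H) (p : H × H) (hp : p ≠ 1) :
    (Set.range fun h : diagonalSubgroup H =>
      (h : H × H) * p * (h : H × H)⁻¹).Infinite := by
  intro hfin
  by_cases h1 : p.1 = 1
  · have h2 : p.2 ≠ 1 := fun h2 => hp (Prod.ext h1 h2)
    refine hH _ h2 ((hfin.image Prod.snd).subset ?_)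
    rintro _ ⟨h, rfl⟩
    exact ⟨_, ⟨⟨(h, h), (mem_diagonalSubgroup_iff H).2 rfl⟩, rfl⟩, rfl⟩
  · refine hH _ h1 ((hfin.image Prod.fst).subset ?_)
    rintro _ ⟨h, rfl⟩
    exact ⟨_, ⟨⟨(h, h), (mem_diagonalSubgroup_iff H).2 rfl⟩, rfl⟩, rfl⟩

theorem IsICC.infinite {H : Type u} [Group H] (hH : IsICC H) [Nontrivial H] : Infinite H := by
  obtain ⟨g, hg⟩ := exists_ne (1 : H)
  by_contra hfin
  rw [not_infinite_iff_finite] at hfin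
  exact hH g hg (Set.toFinite _)

theorem isIrreducibleSubfactor_diagonal (hH : IsICC H) :
    IsIrreducibleSubfactor (subgroupVN (diagonalSubgroup H)) (groupVN (H × H)).alg :=
  isIrreducibleSubfactor_of_relative_commutant _ fun _ hx hc =>
    eq_smul_one_of_infinite_orbits (infinite_diagonal_orbits H hH) hx hc

theorem isTypeII1Factor_diagonal (hH : IsICC H) [Nontrivial H] :
    IsTypeII1Factor (subgroupVN (diagonalSubgroup H)) ∧
      IsTypeII1Factor (groupVN (H × H)).alg := by
  have : Infinite H := hH.infinite
  have : Infinite (diagonalSubgroup H) :=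
    Infinite.of_injective (fun h : H => ⟨(h, h), (mem_diagonalSubgroup_iff H).2 rfl⟩)
      fun _ _ h => (Prod.ext_iff.1 (congrArg Subtype.val h)).1
  have h := isIrreducibleSubfactor_diagonal H hH
  exact ⟨isTypeII1Factor_of_isFactor _ h.1, isTypeII1Factor_groupVN h.2.1⟩

/-- In the expansion of `τ((1 ⊗ T) z)`, a diagonal element `(a, a)` contributes only if `a = 1`,
since `1 ⊗ T` preserves the first coordinate; that single term carries the factor `τ(T)`. -/
theorem isCondExp_amplify_zero {T : L2 H →L[ℂ] L2 H}
    (htr : (groupVN H).trace T = 0) :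
    (groupVN (H × H)).IsCondExp (subgroupVN (diagonalSubgroup H)) (amplify H T) 0 := by
  refine ⟨zero_mem _, fun z hz => ?_⟩
  rw [zero_mul, groupVN_trace, groupVN_trace, mul_apply_eq_comp]
  refine HasSum.unique ?_ (hasSum_apply (amplify H T) (z (delta 1)) 1)
  refine hasSum_zero.congr_fun fun p => ?_
  by_cases hp : p ∈ diagonalSubgroup H
  · obtain ⟨a, rfl⟩ := hp
    change _ * (amplify H T (delta (a, a)) : L2 (H × H)) (1, 1) = 0
    rcases eq_or_ne 1 a with rfl | ha
    · rw [amplify_delta_same, ← groupVN_trace, htr, mul_zero]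
    · rw [amplify_delta_of_ne T ha, mul_zero]
  · rw [support_of_mem_subgroupVN hz hp, zero_mul]

theorem hasRelPropertyGamma_diagonal (h : (groupVN H).HasPropertyGamma) :
    (groupVN (H × H)).HasRelPropertyGamma (subgroupVN (diagonalSubgroup H)) := by
  obtain ⟨w, hw, hcomm⟩ := h
  have hn (n : ℕ) (ξ : L2 H) : ‖w n ξ‖ = ‖ξ‖ := Unitary.norm_map ⟨w n, (hw n).2.1⟩ ξ
  have hb (n : ℕ) : ‖amplify H (w n)‖ ≤ 1 :=
    (norm_amplify_le _).trans
      (ContinuousLinearMap.opNorm_le_bound _ zero_le_one fun ξ => by rw [hn, one_mul])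
  have hmem (n : ℕ) : amplify H (w n) ∈ (groupVN (H × H)).alg := amplify_mem_groupVN (hw n).1
  refine ⟨fun n => amplify H (w n), hmem, ⟨1, hb⟩, fun n => ?_,
    fun n => isCondExp_amplify_zero H (hw n).2.2,
    fun y hy => tendsto_commutator_of_leftReg hmem hb ?_ hy⟩
  · change ‖amplify H (w n) (delta (1, 1))‖ = 1
    rw [norm_amplify_delta, hn, norm_delta]
  · rintro _ ⟨a, rfl⟩
    refine (hcomm _ (leftReg_mem_groupVN a)).congr fun n => ?_
    exact (twoNorm_amplify_commutator (w n) a a).symm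

end ICC

end Diagonal

end

theorem mainTheorem9 :
    (∀ (G : Type u) [Group G] [Countable G] (H : Subgroup G) [Infinite H],
      ¬ RelInnerAmenable H →
        (∀ ω : Ultrafilter ℕ, (∀ n, ω ≠ pure n) →
          (groupVN G).relCommutant ω (subgroupVN H) =
            (groupVN G).centralSeqAlgebra ω (subgroupVN H)) ∧
        (¬ InnerAmenable H →
          (∀ ω : Ultrafilter ℕ, (∀ n, ω ≠ pure n) →
            (groupVN G).relCommutant ω (subgroupVN H) = ⊥) ∧
          IsIrreducibleSubfactor (subgroupVN H) (groupVN G).alg ∧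
          IsTypeII1Factor (subgroupVN H) ∧ IsTypeII1Factor (groupVN G).alg ∧
          (groupVN G).IsFullFactor)) ∧
    (∀ (H : Type v) [Group H] [Countable H], IsICC H →
      (groupVN (H × H)).alg = vnTensor (groupVN H).alg (groupVN H).alg ∧
      IsIrreducibleSubfactor (subgroupVN (diagonalSubgroup H)) (groupVN (H × H)).alg ∧
      (Nontrivial H → IsTypeII1Factor (subgroupVN (diagonalSubgroup H)) ∧
        IsTypeII1Factor (groupVN (H × H)).alg) ∧
      ((groupVN H).HasPropertyGamma →
        (groupVN (H × H)).HasRelPropertyGamma (subgroupVN (diagonalSubgroup H)))) := by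
  refine ⟨fun G _ _ H _ hrel => ⟨fun ω _ => relCommutant_eq_centralSeqAlgebra H hrel ω,
    fun hin => ?_⟩, fun H _ _ hH => ⟨groupVN_prod, isIrreducibleSubfactor_diagonal H hH,
    fun _ => isTypeII1Factor_diagonal H hH, hasRelPropertyGamma_diagonal H⟩⟩
  have hbot (ω : Ultrafilter ℕ) : (groupVN G).relCommutant ω (subgroupVN H) = ⊥ := by
    rw [relCommutant_eq_centralSeqAlgebra H hrel ω, centralSeqAlgebra_eq_bot H hin ω]
  -- Elements of `L(G)` enter as constant sequences, for which a single ultrafilter suffices.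
  have hirr := isIrreducibleSubfactor_of_relative_commutant H fun x hx hc =>
    eq_smul_one_of_relCommutant_eq_bot _ (Filter.hyperfilter ℕ) (hbot _) hx hc
  have : Infinite G := Infinite.of_injective _ (Subtype.val_injective (p := (· ∈ H)))
  refine ⟨fun ω _ => hbot ω, hirr, isTypeII1Factor_of_isFactor H hirr.1,
    isTypeII1Factor_groupVN hirr.2.1, hirr.2.1, fun ω _ => ?_⟩
  rw [eq_bot_iff, ← hbot ω]
  exact inf_le_left.trans (relCommutant_antitone _ ω fun x => subgroupVN_le H)
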